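/- Let $\mathbf k$ be a field. For $n,m\ge 0$ let ${}_nB^c_m$ be the set of isotopy classes of crossingless diagrams in the strip $0\le x\le 1$ that connect in pairs $n$ points on the line $x=0$ and $m$ points on the line $x=1$ by through arcs without critical points (for the projection to the $x$-axis), left returns (joining two left endpoints) and right returns (joining two right endpoints), each return having exactly one critical point. Let $A^c$ be the non-unital $\mathbf k$-algebra with basis $\bigsqcup_{n,m}{}_nB^c_m$ whose product is horizontal concatenation, where a product is zero if the numbers of endpoints do not match or if some component of the concatenation has more than one critical point. Let $1_n\in{}_nB^c_n$ be the diagram of $n$ through arcs. A left $A^c$-module $M$ is called unital if $M=\bigoplus_n 1_nM$. Put $P_n=A^c1_n$, and let the standard module $M_n$ be the quotient of $P_n$ by the submodule spanned by the diagrams with $n$ right endpoints and at least one right return. Let $\widetilde Y_{m,n}\subset{}_mB^c_n$ be the set of diagrams without left returns and without nested right returns (two right returns are nested if the endpoints of one lie between the endpoints of the other); in particular $\widetilde Y_{n,n}=\{1_n\}$. For $1\le i\le m+1$ let $b^i_{m+2}\in{}_{m}B^c_{m+2}$ be the diagram without left returns whose only right return joins the right endpoints $i$ and $i+1$, counted from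 the top. Consider, for $n\ge 0$, the sequence of left $A^c$-modules $$0\to\cdots\to P_{n-2k}^{\widetilde Y_{n-2k,n}}\xrightarrow{d_k}P_{n-2(k-1)}^{\widetilde Y_{n-2(k-1),n}}\xrightarrow{d_{k-1}}\cdots\xrightarrow{d_2}P_{n-2}^{\widetilde Y_{n-2,n}}\xrightarrow{d_1}P_n\to M_n\to 0,\qquad 0\le k\le\lfloor n/2\rfloor,$$ where $P_n\to M_n$ is the quotient map and $d_k$ is the sum of its components $d_{k,\beta,\alpha}\colon P_{n-2k}^{\alpha}\to P_{n-2(k-1)}^{\beta}$ for $\alpha\in\widetilde Y_{n-2k,n}$, $\beta\in\widetilde Y_{n-2(k-1),n}$, defined as follows. There is at most one $i$ with $\alpha=b^i_{n-2(k-1)}\beta$. If there is none, $d_{k,\beta,\alpha}=0$. Otherwise $d_{k,\beta,\alpha}(a)=(-1)^{j-1}\,a\,b^i_{n-2(k-1)}$, where the right return of $\alpha$ that comes from the right return of $b^i_{n-2(k-1)}$ is the $j$-th right return of $\alpha$, counted from top to bottom. Then this sequence is exact, and it is a finite projective resolution of the standard module $M_n$: it has finite length, all its modules are unital, and each term $P_{n-2k}^{\widetilde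 Y_{n-2k,n}}$ is finitely generated and a projective object in the category of unital left $A^c$-modules. -/

import Mathlib

universe u

namespace ChebTL

/-- The positions of the endpoints along the boundary of the strip: left endpoints from top to bottom,
then right endpoints from bottom to top. Endpoints are numbered from `0`, from top to bottom. -/
def pos (n m : ℕ) : Fin n ⊕ Fin m → ℕ
  | .inl i => i
  | .inr j => n + m - 1 - j

/-- The set of diagrams with `n` left and `m` right endpoints. Up to isotopy, a crossingless diagram whose
through arcs have no critical points and whose returns have exactly one is determined by the way it
connects the endpoints: it is a crossingless perfect matching. `mate a` is the endpoint connected to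
`a`. -/
@[ext]
structure Diag (n m : ℕ) where
  mate : Fin n ⊕ Fin m → Fin n ⊕ Fin m
  mate_mate : ∀ a, mate (mate a) = a
  mate_ne : ∀ a, mate a ≠ a
  noncrossing : ∀ a b, ¬ (pos n m a < pos n m b ∧ pos n m b < pos n m (mate a) ∧
    pos n m (mate a) < pos n m (mate b))

namespace Diag

noncomputable instance (n m : ℕ) : Fintype (Diag n m) :=
  Fintype.ofInjective Diag.mate fun _ _ h => Diag.ext h

/-- No component of the concatenation has more than one critical point. As through arcs have none and
returns have one, a component with two returns contains a right return of `x` and a left return of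
`y` that meet at some middle point `p` (circles included); this is what is excluded. -/
def Composable {n m s : ℕ} (x : Diag n m) (y : Diag m s) : Prop :=
  ∀ p : Fin m, ¬ ((∃ q, x.mate (.inr p) = .inr q) ∧ (∃ q, y.mate (.inl p) = .inl q))

/-- The endpoint that is connected to a given one in the concatenation of composable diagrams: follow
the arcs, each component passing through at most two middle points. The two branches
`.inr _ => .inl i` and `.inl _ => .inr j` never occur for composable diagrams. -/
def concat {n m s : ℕ} (x : Diag n m) (y : Diag m s) : Fin n ⊕ Fin s → Fin n ⊕ Fin s
  | .inl i => match x.mate (.inl i) with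
    | .inl i' => .inl i'
    | .inr p => match y.mate (.inl p) with
      | .inr j => .inr j
      | .inl p' => match x.mate (.inr p') with
        | .inl i' => .inl i'
        | .inr _ => .inl i
  | .inr j => match y.mate (.inr j) with
    | .inr j' => .inr j'
    | .inl p => match x.mate (.inr p) with
      | .inl i => .inl i
      | .inr p' => match y.mate (.inl p') with
        | .inr j' => .inr j'
        | .inl _ => .inr j

section
variable {n m s t : ℕ} {x : Diag n m} {y : Diag m s}

theorem nc_inl_inl (x : Diag n m) {i i' k k' : Fin n} (h : x.mate (.inl i) = .inl i')
    (h' : x.mate (.inl k) = .inl k') : ¬ ((i : ℕ) < k ∧ (k : ℕ) < i' ∧ (i' : ℕ) < k') := by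
  have := x.noncrossing (.inl i) (.inl k)
  simpa [h, h', pos] using this

theorem nc_inl_thru (x : Diag n m) {i i' k : Fin n} {p : Fin m} (h : x.mate (.inl i) = .inl i')
    (h' : x.mate (.inl k) = .inr p) : ¬ ((i : ℕ) < k ∧ (k : ℕ) < i') := by
  have := x.noncrossing (.inl i) (.inl k)
  simp only [h, h', pos] at this
  omega

theorem nc_thru_thru (x : Diag n m) {i k : Fin n} {p q : Fin m} (h : x.mate (.inl i) = .inr p)
    (h' : x.mate (.inl k) = .inr q) : (i : ℕ) < k ↔ (p : ℕ) < q := by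
  have := x.noncrossing (.inl i) (.inl k)
  have := x.noncrossing (.inl k) (.inl i)
  have h1 := x.mate_mate (.inl i)
  have h2 := x.mate_mate (.inl k)
  have hne : p = q ↔ i = k := by grind
  rw [Fin.ext_iff, Fin.ext_iff] at hne
  simp only [h, h', pos] at *
  omega

theorem nc_inr_thru (x : Diag n m) {p p' q : Fin m} {k : Fin n} (h : x.mate (.inr p) = .inr p')
    (h' : x.mate (.inl k) = .inr q) : ¬ ((p : ℕ) < q ∧ (q : ℕ) < p') := by
  have h3 := x.mate_mate (.inl k)
  have h4 := x.mate_mate (.inr p)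
  rw [h'] at h3
  rw [h] at h4
  have := x.noncrossing (.inl k) (.inr p')
  simp only [h4, h', pos] at this
  omega

theorem nc_inr_inr (x : Diag n m) {p p' q q' : Fin m} (h : x.mate (.inr p) = .inr p')
    (h' : x.mate (.inr q) = .inr q') : ¬ ((p : ℕ) < q ∧ (q : ℕ) < p' ∧ (p' : ℕ) < q') := by
  have h3 := x.mate_mate (.inr q)
  have h4 := x.mate_mate (.inr p)
  rw [h'] at h3
  rw [h] at h4
  have := x.noncrossing (.inr q') (.inr p')
  simp only [h3, h4, pos] at this
  omega

theorem mate_symm (x : Diag n m) {a b : Fin n ⊕ Fin m} (h : x.mate a = b) : x.mate b = a := by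
  rw [← h, x.mate_mate]

/-- The arcs of a concatenation, sorted by type. -/
theorem concat_inl_cases (h : x.Composable y) (i : Fin n) :
    (∃ i', x.mate (.inl i) = .inl i' ∧ x.mate (.inl i') = .inl i ∧
      concat x y (.inl i) = .inl i') ∨
    (∃ p j, x.mate (.inl i) = .inr p ∧ y.mate (.inl p) = .inr j ∧ x.mate (.inr p) = .inl i ∧
      y.mate (.inr j) = .inl p ∧ concat x y (.inl i) = .inr j) ∨
    (∃ p p' i', x.mate (.inl i) = .inr p ∧ y.mate (.inl p) = .inl p' ∧
      x.mate (.inr p') = .inl i' ∧ x.mate (.inr p) = .inl i ∧ y.mate (.inl p') = .inl p ∧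
      x.mate (.inl i') = .inr p' ∧ concat x y (.inl i) = .inl i') := by
  rcases h1 : x.mate (.inl i) with i' | p
  · exact Or.inl ⟨i', rfl, x.mate_symm h1, by simp [concat, h1]⟩
  · refine Or.inr ?_
    rcases h2 : y.mate (.inl p) with p' | j
    · rcases h3 : x.mate (.inr p') with i' | q
      · exact Or.inr ⟨p, p', i', rfl, h2, h3, x.mate_symm h1, y.mate_symm h2, x.mate_symm h3,
          by simp [concat, h1, h2, h3]⟩
      · exact absurd ⟨⟨q, h3⟩, p, y.mate_symm h2⟩ (h p')
    · exact Or.inl ⟨p, j, rfl, h2, x.mate_symm h1, y.mate_symm h2, by simp [concat, h1, h2]⟩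

theorem concat_inr_cases (h : x.Composable y) (j : Fin s) :
    (∃ j', y.mate (.inr j) = .inr j' ∧ y.mate (.inr j') = .inr j ∧
      concat x y (.inr j) = .inr j') ∨
    (∃ p i, y.mate (.inr j) = .inl p ∧ x.mate (.inr p) = .inl i ∧ y.mate (.inl p) = .inr j ∧
      x.mate (.inl i) = .inr p ∧ concat x y (.inr j) = .inl i) ∨
    (∃ p p' j', y.mate (.inr j) = .inl p ∧ x.mate (.inr p) = .inr p' ∧
      y.mate (.inl p') = .inr j' ∧ y.mate (.inl p) = .inr j ∧ x.mate (.inr p') = .inr p ∧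
      y.mate (.inr j') = .inl p' ∧ concat x y (.inr j) = .inr j') := by
  rcases h1 : y.mate (.inr j) with p | j'
  · refine Or.inr ?_
    rcases h2 : x.mate (.inr p) with i | p'
    · exact Or.inl ⟨p, i, rfl, h2, y.mate_symm h1, x.mate_symm h2, by simp [concat, h1, h2]⟩
    · rcases h3 : y.mate (.inl p') with q | j'
      · exact absurd ⟨⟨p, x.mate_symm h2⟩, q, h3⟩ (h p')
      · exact Or.inr ⟨p, p', j', rfl, h2, h3, y.mate_symm h1, x.mate_symm h2, y.mate_symm h3,
          by simp [concat, h1, h2, h3]⟩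
  · exact Or.inl ⟨j', rfl, y.mate_symm h1, by simp [concat, h1]⟩

theorem concat_mate (h : x.Composable y) (a : Fin n ⊕ Fin s) :
    concat x y (concat x y a) = a := by
  rcases a with i | j
  · rcases concat_inl_cases h i with ⟨i', h1, h2, e⟩ | ⟨p, j, h1, h2, h3, h4, e⟩ |
      ⟨p, p', i', h1, h2, h3, h4, h5, h6, e⟩ <;> rw [e] <;> simp [concat, *]
  · rcases concat_inr_cases h j with ⟨i', h1, h2, e⟩ | ⟨p, j, h1, h2, h3, h4, e⟩ |
      ⟨p, p', i', h1, h2, h3, h4, h5, h6, e⟩ <;> rw [e] <;> simp [concat, *]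

theorem concat_ne (h : x.Composable y) (a : Fin n ⊕ Fin s) :
    concat x y a ≠ a := by
  have hx := x.mate_ne
  have hy := y.mate_ne
  rcases a with i | j
  · have := concat_inl_cases h i
    grind
  · have := concat_inr_cases h j
    grind

theorem concat_noncrossing (h : x.Composable y) (a b : Fin n ⊕ Fin s) :
    ¬ (pos n s a < pos n s b ∧ pos n s b < pos n s (concat x y a) ∧
    pos n s (concat x y a) < pos n s (concat x y b)) := by
  rcases a with i | j <;> rcases b with i' | j'
  · rcases concat_inl_cases h i with ⟨u1, h1u, h2u, eu⟩ | ⟨pu, u1, h1u, h2u, h3u, h4u, eu⟩ |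
      ⟨pu, qu, u1, h1u, h2u, h3u, h4u, h5u, h6u, eu⟩ <;>
    rcases concat_inl_cases h i' with ⟨v1, h1v, h2v, ev⟩ | ⟨pv, v1, h1v, h2v, h3v, h4v, ev⟩ |
      ⟨pv, qv, v1, h1v, h2v, h3v, h4v, h5v, h6v, ev⟩ <;>
    simp only [eu, ev, pos]
    · have := x.nc_inl_inl h1u h1v
      omega
    · have := x.nc_inl_thru h1u h1v
      omega
    · have := x.nc_inl_thru h1u h1v
      omega
    · omega
    · have := x.nc_thru_thru h1u h1v
      have := y.nc_thru_thru h2u h2v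
      omega
    · omega
    · have := x.nc_inl_thru h1v h6u
      omega
    · have := x.nc_thru_thru h1u h1v
      have := x.nc_thru_thru h1v h6u
      have := y.nc_inl_thru h2u h2v
      omega
    · have := x.nc_thru_thru h1u h1v
      have := x.nc_thru_thru h1v h6u
      have := x.nc_thru_thru h6u h6v
      have := y.nc_inl_inl h2u h2v
      omega
  · rcases concat_inl_cases h i with ⟨u1, h1u, h2u, eu⟩ | ⟨pu, u1, h1u, h2u, h3u, h4u, eu⟩ |
      ⟨pu, qu, u1, h1u, h2u, h3u, h4u, h5u, h6u, eu⟩ <;>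
    rcases concat_inr_cases h j' with ⟨v1, h1v, h2v, ev⟩ | ⟨pv, v1, h1v, h2v, h3v, h4v, ev⟩ |
      ⟨pv, qv, v1, h1v, h2v, h3v, h4v, h5v, h6v, ev⟩ <;>
    simp only [eu, ev, pos]
    · omega
    · omega
    · omega
    · have := y.nc_inr_thru h2v h2u
      omega
    · omega
    · have := y.nc_thru_thru h2u h4v
      have := y.nc_thru_thru h3v h2u
      have := x.nc_inr_thru h5v h1u
      omega
    · omega
    · omega
    · omega
  · simp only [pos]
    omega
  · rcases concat_inr_cases h j with ⟨u1, h1u, h2u, eu⟩ | ⟨pu, u1, h1u, h2u, h3u, h4u, eu⟩ |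
      ⟨pu, qu, u1, h1u, h2u, h3u, h4u, h5u, h6u, eu⟩ <;>
    rcases concat_inr_cases h j' with ⟨v1, h1v, h2v, ev⟩ | ⟨pv, v1, h1v, h2v, h3v, h4v, ev⟩ |
      ⟨pv, qv, v1, h1v, h2v, h3v, h4v, h5v, h6v, ev⟩ <;>
    simp only [eu, ev, pos]
    · have := y.nc_inr_inr h2v h2u
      omega
    · omega
    · have := y.nc_inr_thru h2u h4v
      omega
    · omega
    · omega
    · omega
    · have := y.nc_inr_thru h2v h3u
      omega
    · omega
    · have := y.nc_thru_thru h3v h3u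
      have := y.nc_thru_thru h3u h4v
      have := y.nc_thru_thru h4v h4u
      have := x.nc_inr_inr h5v h5u
      omega

/-- The concatenation of two composable diagrams. -/
def glue (x : Diag n m) (y : Diag m s) (h : x.Composable y) : Diag n s :=
  ⟨concat x y, concat_mate h, concat_ne h, concat_noncrossing h⟩

@[simp] theorem glue_mate (h : x.Composable y) : (x.glue y h).mate = concat x y := rfl

open Classical in
/-- The product of two diagrams: their concatenation, or zero (`none`) if some component of it has more
than one critical point. -/
noncomputable def comp {n m s : ℕ} (x : Diag n m) (y : Diag m s) : Option (Diag n s) :=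
  if h : x.Composable y then some (x.glue y h) else none

theorem composable_right {z : Diag s t} (h : x.Composable y) (h' : (x.glue y h).Composable z) :
    y.Composable z := by
  rintro p ⟨⟨q, hq⟩, hz⟩
  exact h' p ⟨⟨q, by simp [glue, concat, hq]⟩, hz⟩

theorem composable_left {z : Diag s t} (h : y.Composable z) (h' : x.Composable (y.glue z h)) :
    x.Composable y := by
  rintro p ⟨hx, ⟨q, hq⟩⟩
  exact h' p ⟨hx, ⟨q, by simp [glue, concat, hq]⟩⟩

theorem composable_glue_iff {z : Diag s t} (h : x.Composable y) (h' : y.Composable z) :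
    (x.glue y h).Composable z ↔ x.Composable (y.glue z h') := by
  constructor
  · rintro H p ⟨⟨p', hp⟩, ⟨q, hq⟩⟩
    rcases concat_inl_cases h' p with ⟨i', h1, h2, e⟩ | ⟨p, j, h1, h2, h3, h4, e⟩ |
      ⟨r, r', i', h1, h2, h3, h4, h5, h6, e⟩
    · exact h p ⟨⟨p', hp⟩, ⟨_, h1⟩⟩
    · simp [glue, e] at hq
    · refine H r ⟨?_, ⟨_, h2⟩⟩
      rcases concat_inr_cases h r with ⟨j', k1, k2, e'⟩ | ⟨k, l, k1, k2, k3, k4, e'⟩ |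
        ⟨k, k', j', k1, k2, k3, k4, k5, k6, e'⟩
      · exact ⟨_, e'⟩
      · grind
      · exact ⟨_, e'⟩
  · rintro H p ⟨⟨p', hp⟩, ⟨q, hq⟩⟩
    rcases concat_inr_cases h p with ⟨i', h1, h2, e⟩ | ⟨p, j, h1, h2, h3, h4, e⟩ |
      ⟨r, r', i', h1, h2, h3, h4, h5, h6, e⟩
    · exact h' p ⟨⟨_, h1⟩, ⟨_, hq⟩⟩
    · simp [glue, e] at hp
    · refine H r ⟨⟨_, h2⟩, ?_⟩
      rcases concat_inl_cases h' r with ⟨j', k1, k2, e'⟩ | ⟨k, l, k1, k2, k3, k4, e'⟩ |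
        ⟨k, k', j', k1, k2, k3, k4, k5, k6, e'⟩
      · exact ⟨_, e'⟩
      · grind
      · exact ⟨_, e'⟩

theorem glue_assoc {z : Diag s t} (hxy : x.Composable y) (hyz : y.Composable z)
    (h : (x.glue y hxy).Composable z) (h' : x.Composable (y.glue z hyz)) :
    (x.glue y hxy).glue z h = x.glue (y.glue z hyz) h' := by
  ext1
  funext a
  simp only [glue_mate]
  rcases a with i | j
  · rcases h1 : x.mate (.inl i) with i' | p
    · simp [concat, h1]
    rcases h2 : y.mate (.inl p) with p' | q
    · rcases h3 : x.mate (.inr p') with i' | p''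
      · simp [concat, h1, h2, h3]
      · exact absurd ⟨⟨_, h3⟩, ⟨_, y.mate_symm h2⟩⟩ (hxy p')
    rcases h3 : z.mate (.inl q) with q' | k
    · rcases h4 : y.mate (.inr q') with p' | q''
      · rcases h5 : x.mate (.inr p') with i' | p''
        · simp [concat, h1, h2, h3, h4, h5]
        · rcases h6 : y.mate (.inl p'') with r | q''
          · exact absurd ⟨⟨_, x.mate_symm h5⟩, ⟨_, h6⟩⟩ (hxy p'')
          · exact absurd ⟨⟨q'', by simp [concat, h4, h5, h6]⟩, ⟨_, z.mate_symm h3⟩⟩ (h q')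
      · exact absurd ⟨⟨_, h4⟩, ⟨_, z.mate_symm h3⟩⟩ (hyz q')
    · simp [concat, h1, h2, h3]
  · rcases h1 : z.mate (.inr j) with q | j'
    · rcases h2 : y.mate (.inr q) with p | q'
      · rcases h3 : x.mate (.inr p) with i | p'
        · simp [concat, h1, h2, h3]
        · rcases h4 : y.mate (.inl p') with p'' | q'
          · exact absurd ⟨⟨_, x.mate_symm h3⟩, ⟨_, h4⟩⟩ (hxy p')
          · rcases h5 : z.mate (.inl q') with q'' | k
            · exact absurd ⟨⟨q, by simp [concat, x.mate_symm h3, y.mate_symm h4, y.mate_symm h2]⟩,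
                ⟨_, h5⟩⟩ (h q')
            · simp [concat, h1, h2, h3, h4, h5]
      · rcases h3 : z.mate (.inl q') with q'' | k
        · exact absurd ⟨⟨_, y.mate_symm h2⟩, ⟨_, h3⟩⟩ (hyz q')
        · simp [concat, h1, h2, h3]
    · simp [concat, h1]

end

theorem comp_assoc {n m s t : ℕ} (x : Diag n m) (y : Diag m s) (z : Diag s t) :
    (x.comp y).bind (fun w => w.comp z) = (y.comp z).bind (fun w => x.comp w) := by
  by_cases hxy : x.Composable y <;> by_cases hyz : y.Composable z
  · have := composable_glue_iff hxy hyz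
    by_cases h : (x.glue y hxy).Composable z
    · simp [comp, hxy, hyz, h, this.1 h, glue_assoc hxy hyz h (this.1 h)]
    · simp [comp, hxy, hyz, h, mt this.2 h]
  · simp [comp, hxy, hyz, mt (composable_right hxy) hyz]
  · simp [comp, hxy, hyz, mt (composable_left hyz) hxy]
  · simp [comp, hxy, hyz]

/-- The diagram `1_n` of `n` through arcs. -/
def one (n : ℕ) : Diag n n where
  mate := Sum.swap
  mate_mate := by simp
  mate_ne := by rintro (a | a) <;> simp
  noncrossing := by
    rintro (a | a) (b | b) <;> simp [pos] <;> omega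

theorem comp_one {n m : ℕ} (x : Diag n m) : x.comp (one m) = some x := by
  have h : x.Composable (one m) := by
    rintro p ⟨_, q, h⟩
    simp [one] at h
  rw [comp, dif_pos h]
  congr 1
  ext1
  have hx := x.mate_mate
  funext a
  rcases a with i | j
  · rcases concat_inl_cases h i with ⟨i', h1, h2, e⟩ | ⟨p, j, h1, h2, h3, h4, e⟩ |
      ⟨p, p', i', h1, h2, h3, h4, h5, h6, e⟩
    · simp [e, h1]
    · simp only [one, Sum.swap_inl] at h2
      cases h2
      simp [e, h1]
    · simp [one] at h2
  · simp only [glue_mate, concat, one, Sum.swap_inr]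
    rcases x.mate (.inr j) <;> rfl


/-- The diagram `b^i` with `m` left and `m' = m + 2` right endpoints, without left returns, whose only
right return joins the right endpoints `i` and `i + 1` (numbered from `0`, from top to bottom). -/
def cap {m m' : ℕ} (h : m + 2 = m') (i : Fin (m + 1)) : Diag m m' where
  mate
    | .inl p => .inr ⟨if (p : ℕ) < i then p else p + 2, by grind⟩
    | .inr q =>
      if h1 : (q : ℕ) < i then .inl ⟨q, by omega⟩
      else if h2 : (q : ℕ) = i then .inr ⟨i + 1, by omega⟩
      else if h3 : (q : ℕ) = i + 1 then .inr ⟨i, by omega⟩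
      else .inl ⟨q - 2, by omega⟩
  mate_mate := by rintro (a | a) <;> grind
  mate_ne := by rintro (a | a) <;> grind
  noncrossing := by
    rintro (a | a) (b | b) <;> grind [pos]

/-- A right return: an arc joining two right endpoints. -/
def HasRightReturn {n m : ℕ} (x : Diag n m) : Prop :=
  ∃ p q, x.mate (.inr p) = .inr q

/-- A left return: an arc joining two left endpoints. -/
def HasLeftReturn {n m : ℕ} (x : Diag n m) : Prop :=
  ∃ p q, x.mate (.inl p) = .inl q

/-- Two right returns are nested if the endpoints of one of them, `q < q'`, lie between the
endpoints `p < p'` of the other one. -/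
def HasNestedRightReturns {n m : ℕ} (x : Diag n m) : Prop :=
  ∃ p q q' p', x.mate (.inr p) = .inr p' ∧ x.mate (.inr q) = .inr q' ∧ p < q ∧ q < q' ∧ q' < p'

end Diag

/-- The set of all diagrams, with arbitrary numbers of left and right endpoints. -/
abbrev Diagram : Type := Σ n m : ℕ, Diag n m

/-- The product of two basis diagrams; `none` stands for zero. -/
noncomputable def Diagram.mul : Diagram → Diagram → Option Diagram
  | ⟨n, m, x⟩, ⟨m', s, y⟩ =>
    if h : m = m' then (x.comp (h ▸ y : Diag m s)).map fun w => ⟨n, s, w⟩ else none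

theorem Diagram.mul_assoc (a b c : Diagram) :
    (a.mul b).bind (fun w => w.mul c) = (b.mul c).bind (fun w => a.mul w) := by
  obtain ⟨n, m, x⟩ := a
  obtain ⟨m', s, y⟩ := b
  obtain ⟨s', t, z⟩ := c
  by_cases h : m = m' <;> by_cases h' : s = s'
  · subst h h'
    have := congrArg (Option.map fun w => (⟨n, t, w⟩ : Diagram)) (Diag.comp_assoc x y z)
    simpa [Diagram.mul, Option.bind_map, Option.map_bind, Function.comp_def] using this
  · subst h
    simp [Diagram.mul, h', Option.bind_map]
  · subst h'
    simp [Diagram.mul, h, Option.bind_map]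
  · simp [Diagram.mul, h, h']

/-- The algebra `A^c`: the vector space with basis the set of all diagrams. -/
def Alg (k : Type*) [Field k] : Type _ := Diagram →₀ k

namespace Alg

variable (k : Type*) [Field k]

noncomputable instance : AddCommGroup (Alg k) := inferInstanceAs (AddCommGroup (Diagram →₀ k))
noncomputable instance : Module k (Alg k) := inferInstanceAs (Module k (Diagram →₀ k))

/-- The basis of `A^c` consisting of the diagrams. -/
noncomputable def basis : Module.Basis Diagram k (Alg k) :=
  Module.Basis.ofRepr (show Alg k ≃ₗ[k] (Diagram →₀ k) from LinearEquiv.refl k (Diagram →₀ k))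

/-- The bilinear extension of the product of diagrams. -/
noncomputable def mulHom : Alg k →ₗ[k] Alg k →ₗ[k] Alg k :=
  (basis k).constr k fun a => (basis k).constr k fun b => (a.mul b).elim 0 (basis k)

noncomputable instance : Mul (Alg k) := ⟨fun x y => mulHom k x y⟩

theorem mul_def (x y : Alg k) : x * y = mulHom k x y := rfl

theorem basis_mul (a b : Diagram) :
    basis k a * basis k b = (a.mul b).elim 0 (basis k) := by
  simp [mul_def, mulHom, Module.Basis.constr_basis]

variable {k} in
theorem induction {p : Alg k → Prop} (x : Alg k) (zero : p 0) (add : ∀ x y, p x → p y → p (x + y))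
    (basis : ∀ a, p (basis k a)) (smul : ∀ (c : k) x, p x → p (c • x)) : p x := by
  refine Submodule.span_induction (p := fun x _ => p x) ?_ zero (fun x y _ _ => add x y)
    (fun c x _ => smul c x) ((Alg.basis k).mem_span x)
  rintro _ ⟨a, rfl⟩
  exact basis a

theorem basis_mul_assoc (a b c : Diagram) : basis k a * basis k b * basis k c =
    basis k a * (basis k b * basis k c) := by
  have h := congrArg (fun o => Option.elim o 0 (basis k)) (Diagram.mul_assoc a b c)
  have e1 : ∀ o : Option Diagram, (o.bind fun w => w.mul c).elim 0 (basis k) =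
      o.elim 0 (basis k) * basis k c := by
    rintro (_ | w)
    · simp [mul_def]
    · simp [basis_mul]
  have e2 : ∀ o : Option Diagram, (o.bind fun w => a.mul w).elim 0 (basis k) =
      basis k a * o.elim 0 (basis k) := by
    rintro (_ | w)
    · simp [mul_def]
    · simp [basis_mul]
  simp only [e1, e2] at h
  simpa only [basis_mul] using h

theorem mul_assoc' (x y z : Alg k) : x * y * z = x * (y * z) := by
  induction x using Alg.induction with
  | zero => simp [mul_def]
  | add x x' h h' =>
    simp only [mul_def, map_add, LinearMap.add_apply] at *
    rw [h, h']
  | smul c x h =>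
    simp only [mul_def, map_smul, LinearMap.smul_apply] at *
    rw [h]
  | basis a =>
    induction y using Alg.induction with
    | zero => simp [mul_def]
    | add x x' h h' =>
      simp only [mul_def, map_add, LinearMap.add_apply] at *
      rw [h, h']
    | smul c x h =>
      simp only [mul_def, map_smul, LinearMap.smul_apply] at *
      rw [h]
    | basis b =>
      induction z using Alg.induction with
      | zero => simp [mul_def]
      | add x x' h h' =>
        simp only [mul_def, map_add] at *
        rw [h, h']
      | smul c x h =>
        simp only [mul_def, map_smul] at *
        rw [h]
      | basis c => exact basis_mul_assoc k a b c

noncomputable instance : NonUnitalRing (Alg k) where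
  left_distrib x y z := by simp [mul_def]
  right_distrib x y z := by simp [mul_def]
  zero_mul x := by simp [mul_def]
  mul_zero x := by simp [mul_def]
  mul_assoc := mul_assoc' k

instance : IsScalarTower k (Alg k) (Alg k) := ⟨fun c x y => by simp [mul_def]⟩
instance : SMulCommClass k (Alg k) (Alg k) := ⟨fun c x y => by simp [mul_def]⟩

end Alg

section Modules

variable (k : Type*) [Field k]

/-- The unitization `k ⊕ A^c`. A (`k`-linear) left module over the non-unital algebra `A^c` is the same
thing as a left module over this unital ring. -/
abbrev UAlg : Type _ := Unitization k (Alg k)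

/-- A diagram as an element of the (unitized) algebra. -/
noncomputable def dgm {n m : ℕ} (x : Diag n m) : UAlg k :=
  (Alg.basis k ⟨n, m, x⟩ : Alg k)

/-- The idempotent `1_n`. -/
noncomputable def idem (n : ℕ) : UAlg k := dgm k (Diag.one n)

theorem dgm_mul_idem {n m : ℕ} (x : Diag n m) : dgm k x * idem k m = dgm k x := by
  rw [idem, dgm, dgm, ← Unitization.inr_mul, Alg.basis_mul]
  simp [Diagram.mul, Diag.comp_one]

/-- The subgroup `1_n M` of a module `M`. -/
noncomputable def idemPart (M : Type*) [AddCommGroup M] [Module (UAlg k) M] (n : ℕ) : AddSubgroup M :=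
  (DistribSMul.toAddMonoidHom M (idem k n)).range

/-- A module `M` is unital if `M = ⨁ₙ 1_n M`. -/
def IsUnital (M : Type*) [AddCommGroup M] [Module (UAlg k) M] : Prop :=
  DirectSum.IsInternal (idemPart k M)

/-- The category of unital left `A^c`-modules. -/
abbrev UnitalMod (k : Type u) [Field k] : Type _ :=
  CategoryTheory.ObjectProperty.FullSubcategory (fun M : ModuleCat.{u} (UAlg k) => IsUnital k M)

/-- The projective module `P_n = A^c 1_n`, a left ideal. -/
noncomputable def P (n : ℕ) : Submodule (UAlg k) (UAlg k) := Submodule.span _ {idem k n}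

theorem dgm_mem_P {n m : ℕ} (x : Diag n m) : dgm k x ∈ P k m :=
  Submodule.mem_span_singleton.2 ⟨dgm k x, dgm_mul_idem k x⟩

/-- The submodule `I_n` of `P_n` spanned by the diagrams with `n` right endpoints and at least one
right return. -/
noncomputable def I (n : ℕ) : Submodule (UAlg k) (P k n) :=
  Submodule.span _ {a | ∃ (l : ℕ) (x : Diag l n), x.HasRightReturn ∧ (a : UAlg k) = dgm k x}

/-- The standard module `M_n = P_n / I_n`. -/
abbrev StdMod (n : ℕ) : Type _ := P k n ⧸ I k n

/-- Right multiplication `a ↦ a c` by a diagram `c`, as a map `P_m → P_m'`. -/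
noncomputable def rightMul {m m' : ℕ} (c : Diag m m') : P k m →ₗ[UAlg k] P k m' :=
  LinearMap.toSpanSingleton (UAlg k) (P k m') ⟨dgm k c, dgm_mem_P k c⟩ ∘ₗ (P k m).subtype

end Modules

/-- `Ỹ_{m,n}`: diagrams without left returns and without nested right returns. -/
def YTilde (m n : ℕ) : Set (Diag m n) :=
  {α | ¬ α.HasLeftReturn ∧ ¬ α.HasNestedRightReturns}

/-- The index set `Ỹ_{n-2j,n}` of the `j`-th term of the resolution, empty if `2 j > n`. -/
abbrev Idx (n j : ℕ) : Type := {α : Diag (n - 2 * j) n // 2 * j ≤ n ∧ α ∈ YTilde (n - 2 * j) n}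

noncomputable instance (n j : ℕ) : Fintype (Idx n j) := Fintype.ofFinite _

/-- The order, counted from `1` and from top to bottom, among the right returns of `α` of the one whose
upper endpoint is the right endpoint of the through arc of `β` that starts at the left endpoint `i`. -/
noncomputable def returnOrder {m m' n : ℕ} (α : Diag m n) (β : Diag m' n) (i : Fin m') : ℕ :=
  Set.ncard {q : Fin n | ∃ q' p, α.mate (.inr q) = .inr q' ∧ q < q' ∧
    β.mate (.inl i) = .inr p ∧ q ≤ p}

section Resolution

variable (k : Type*) [Field k] (n : ℕ)

/-- The `j`-th term `P_{n-2j}^{Ỹ_{n-2j,n}}`. -/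
abbrev Term (j : ℕ) : Type _ := Idx n j → P k (n - 2 * j)

open Classical in
/-- The component `d_{j+1,β,α}` of the differential: if `α = b^i β` for some (necessarily unique) `i`, it is
`a ↦ (-1)^(r-1) a b^i`, where `r` is the order of the right return of `α` that comes from `b^i`;
otherwise it is zero. -/
noncomputable def dComp {j : ℕ} (α : Idx n (j + 1)) (β : Idx n j) :
    P k (n - 2 * (j + 1)) →ₗ[UAlg k] P k (n - 2 * j) :=
  have hm : n - 2 * (j + 1) + 2 = n - 2 * j := by have := α.2.1; omega
  if h : ∃ i, (Diag.cap hm i).comp β.1 = some α.1 then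
    (-1 : ℤ) ^ (returnOrder α.1 β.1 ⟨h.choose, by omega⟩ - 1) • rightMul k (Diag.cap hm h.choose)
  else 0

/-- The differential `d_{j+1}`, the sum of its components. -/
noncomputable def d (j : ℕ) : Term k n (j + 1) →ₗ[UAlg k] Term k n j :=
  LinearMap.pi fun β => ∑ α, dComp k n α β ∘ₗ LinearMap.proj α

/-- The augmentation `P_n → M_n`, the quotient map; the index set `Ỹ_{n,n} = {1_n}` of the term in degree `0`
has one element. -/
noncomputable def augmentation : Term k n 0 →ₗ[UAlg k] StdMod k n :=
  (I k n).mkQ ∘ₗ ∑ α, (LinearMap.proj α : Term k n 0 →ₗ[UAlg k] P k n)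

end Resolution

end ChebTL

/-!
A diagram `α` in `Ỹ_{n-2j,n}` is determined by its right returns, which join adjacent endpoints, and
every set of `j` disjoint adjacent pairs of right endpoints occurs (`Idx.exists_upper_eq`,
`Idx.ext_upper`). Since `α` has no left returns, a product `a α` of diagrams is never zero, and a
diagram `D` is of the form `a α`, for a unique `a`, if and only if the right returns of `α` are right
returns of `D` (`exists_glue_eq`, `glue_left_injective`). So the basis of the `j`-th term that consists
of the pairs `(α, a)` is in bijection with the pairs `(D, S)` of a diagram `D` with `n` right endpoints
and a set `S` of `j` innermost right returns of `D`: put `D = a α` and let `S` be the set of right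
returns of `α` (`pair_injective`, `exists_pair_eq`).

The identity `a b^i β = a α` shows that the differential keeps `D` and removes the elements of `S` one
by one, with alternating signs (`toPairs_d`). Hence the complex is the direct sum over all `D` of the
augmented chain complexes of the full simplices whose vertices are the innermost right returns of `D`.
A nonempty simplex is contracted by adding its first vertex (`boundary_cone_add_cone_boundary`), and
the simplex is empty only if `D` has no right return at all (`inner_nonempty`). Those `D` contribute
exactly the standard module in degree zero.

Unitality passes to quotients and finite powers, and `P_m` is unital because its basis elements are.
An epimorphism of unital modules is surjective, because its cokernel is unital. As `P_m` is generated
by the idempotent `1_m`, it lifts along surjections.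
-/

namespace ChebTL

namespace Diag

/-! ### Factoring a diagram through one without left returns -/

section Factor

variable {l m n : ℕ} {α : Diag m n}

theorem exists_mate_inl (hα : ¬ α.HasLeftReturn) (i : Fin m) : ∃ p, α.mate (.inl i) = .inr p := by
  rcases h : α.mate (.inl i) with q | p
  · exact absurd ⟨i, q, h⟩ hα
  · exact ⟨p, rfl⟩

/-- The right endpoint of the through arc that starts at the left endpoint `i`, for a diagram without
left returns. -/
noncomputable def thru (hα : ¬ α.HasLeftReturn) (i : Fin m) : Fin n :=
  (exists_mate_inl hα i).choose

theorem mate_inl (hα : ¬ α.HasLeftReturn) (i : Fin m) : α.mate (.inl i) = .inr (thru hα i) :=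
  (exists_mate_inl hα i).choose_spec

theorem mate_thru (hα : ¬ α.HasLeftReturn) (i : Fin m) : α.mate (.inr (thru hα i)) = .inl i :=
  α.mate_symm (mate_inl hα i)

theorem thru_eq (hα : ¬ α.HasLeftReturn) {i : Fin m} {p : Fin n} (h : α.mate (.inr p) = .inl i) :
    thru hα i = p := by
  have := mate_inl hα i
  rw [α.mate_symm h] at this
  simpa using this.symm

theorem thru_strictMono (hα : ¬ α.HasLeftReturn) : StrictMono (thru hα) := fun i j h =>
  (α.nc_thru_thru (mate_inl hα i) (mate_inl hα j)).1 h

/-- The through arcs end exactly at the right endpoints that are not on a right return. -/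
theorem range_thru (hα : ¬ α.HasLeftReturn) :
    Set.range (thru hα) = {p | ∀ q, α.mate (.inr p) ≠ .inr q} := by
  ext p
  constructor
  · rintro ⟨i, rfl⟩ q
    simp [mate_thru hα]
  · intro h
    rcases h' : α.mate (.inr p) with i | q
    · exact ⟨i, thru_eq hα h'⟩
    · exact absurd h' (h q)

theorem composable_of_not_hasLeftReturn (hα : ¬ α.HasLeftReturn) (a : Diag l m) :
    a.Composable α :=
  fun p h => hα ⟨p, h.2⟩

/-- The endpoints of a diagram `a` as endpoints of the concatenation `a α`: a right endpoint of `a` is moved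
along the through arc of `α` that starts there. -/
noncomputable def along (l : ℕ) (hα : ¬ α.HasLeftReturn) : Fin l ⊕ Fin m → Fin l ⊕ Fin n :=
  Sum.map id (thru hα)

theorem along_injective (hα : ¬ α.HasLeftReturn) : Function.Injective (along l hα) :=
  Function.injective_id.sumMap (thru_strictMono hα).injective

theorem pos_along_lt (hα : ¬ α.HasLeftReturn) (x y : Fin l ⊕ Fin m) :
    pos l n (along l hα x) < pos l n (along l hα y) ↔ pos l m x < pos l m y := by
  rcases x with i | p <;> rcases y with j | q
  · simp [along, pos]
  · simp only [along, pos, Sum.map_inl, Sum.map_inr, id]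
    omega
  · simp only [along, pos, Sum.map_inl, Sum.map_inr, id]
    omega
  · have := (thru_strictMono hα).lt_iff_lt (a := q) (b := p)
    simp only [along, pos, Sum.map_inr, Fin.lt_def] at *
    omega

theorem concat_along (hα : ¬ α.HasLeftReturn) (a : Diag l m) (x : Fin l ⊕ Fin m) :
    concat a α (along l hα x) = along l hα (a.mate x) := by
  rcases x with i | p
  · rcases h : a.mate (.inl i) with i' | p
    · simp [concat, along, h]
    · simp [concat, along, h, mate_inl hα]
  · rcases h : a.mate (.inr p) with i' | p'
    · simp [concat, along, h, mate_thru hα]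
    · simp [concat, along, h, mate_thru hα, mate_inl hα]

theorem concat_inr_of_mate {a : Diag l m} {q q' : Fin n} (h : α.mate (.inr q) = .inr q') :
    concat a α (.inr q) = .inr q' := by
  simp [concat, h]

/-- Right multiplication by a diagram without left returns is injective: the arcs of `a` can be read off
from `a α` by `concat_along`. -/
theorem glue_left_injective (hα : ¬ α.HasLeftReturn) {a a' : Diag l m}
    (h : a.glue α (composable_of_not_hasLeftReturn hα a) =
      a'.glue α (composable_of_not_hasLeftReturn hα a')) : a = a' := by
  ext1
  funext x
  have := congrFun (congrArg Diag.mate h) (along l hα x)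
  simp only [glue_mate, concat_along] at this
  exact along_injective hα this

/-- A diagram that contains the right returns of `α` is of the form `a α`: delete the right returns of `α`
and shrink the strip. -/
theorem exists_glue_eq (hα : ¬ α.HasLeftReturn) (D : Diag l n)
    (hD : ∀ q q', α.mate (.inr q) = .inr q' → D.mate (.inr q) = .inr q') :
    ∃ a : Diag l m, a.glue α (composable_of_not_hasLeftReturn hα a) = D := by
  have key : ∀ x, ∃ y, D.mate (along l hα x) = along l hα y := by
    intro x
    rcases h : D.mate (along l hα x) with i | q
    · exact ⟨.inl i, rfl⟩
    rcases h' : α.mate (.inr q) with p | q'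
    · exact ⟨.inr p, by simp [along, thru_eq hα h']⟩
    · have h1 := hD _ _ h'
      rw [D.mate_symm h] at h1
      rcases x with i | p
      · simp [along] at h1
      · simp only [along, Sum.map_inr, Sum.inr.injEq] at h1
        have h2 := mate_thru hα p
        rw [h1, α.mate_symm h'] at h2
        simp at h2
  choose f hf using key
  refine ⟨⟨f, fun x => ?_, fun x hx => ?_, fun x y => ?_⟩, ?_⟩
  · apply along_injective hα
    rw [← hf, ← hf, D.mate_mate]
  · apply D.mate_ne (along l hα x)
    rw [hf, hx]
  · simpa only [hf, pos_along_lt] using D.noncrossing (along l hα x) (along l hα y)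
  · ext1
    funext y
    rcases y with i | q
    · exact (concat_along hα _ (.inl i)).trans (hf (.inl i)).symm
    · rcases h : α.mate (.inr q) with p | q'
      · have e : (.inr q : Fin l ⊕ Fin n) = along l hα (.inr p) := by simp [along, thru_eq hα h]
        rw [e]
        exact (concat_along hα _ (.inr p)).trans (hf (.inr p)).symm
      · rw [hD _ _ h, glue_mate, concat_inr_of_mate h]

end Factor

/-! ### Right returns -/

section Returns

variable {l m m' n : ℕ}

/-- What lies below a right return is closed under the matching. -/
theorem exists_mate_between (x : Diag l n) {q q' s : Fin n} (h : x.mate (.inr q) = .inr q')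
    (h1 : q < s) (h2 : s < q') : ∃ r, x.mate (.inr s) = .inr r ∧ q < r ∧ r < q' := by
  rcases hs : x.mate (.inr s) with i | r
  · exact absurd ⟨h1, h2⟩ (x.nc_inr_thru h (x.mate_symm hs))
  · have a1 := x.nc_inr_inr h hs
    have a2 := x.nc_inr_inr (x.mate_symm hs) h
    have h3 : r ≠ q := by
      rintro rfl
      rw [x.mate_symm hs] at h
      simp only [Sum.inr.injEq] at h
      omega
    have h4 : r ≠ q' := by
      rintro rfl
      have := x.mate_symm h
      rw [x.mate_symm hs] at this
      simp only [Sum.inr.injEq] at this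
      omega
    exact ⟨r, rfl, by omega, by omega⟩

/-- Without nesting, a right return joins adjacent endpoints. -/
theorem val_eq_of_not_nested {x : Diag l n} (hx : ¬ x.HasNestedRightReturns) {q q' : Fin n}
    (h : x.mate (.inr q) = .inr q') (hlt : q < q') : (q' : ℕ) = q + 1 := by
  by_contra hne
  obtain ⟨r, h1, h2, h3⟩ := x.exists_mate_between h (s := ⟨q + 1, by omega⟩)
    (Fin.lt_def.2 (by simp)) (Fin.lt_def.2 (by simp only; omega))
  have h4 : r ≠ ⟨q + 1, by omega⟩ := by
    intro h4
    exact x.mate_ne _ (h4 ▸ h1)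
  refine hx ⟨q, ⟨q + 1, by omega⟩, r, q', h, h1, Fin.lt_def.2 (by simp), ?_, h3⟩
  rw [Ne, Fin.ext_iff] at h4
  simp only [Fin.lt_def] at *
  omega

open Classical in
/-- The upper endpoints of the right returns of a diagram. -/
noncomputable def upper (x : Diag l n) : Finset (Fin n) :=
  {q | ∃ q', x.mate (.inr q) = .inr q' ∧ q < q'}

theorem mem_upper {x : Diag l n} {q : Fin n} :
    q ∈ x.upper ↔ ∃ q', x.mate (.inr q) = .inr q' ∧ q < q' := by
  simp [upper]

open Classical in
/-- The upper endpoints of the innermost right returns of a diagram, those that join adjacent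
endpoints. -/
noncomputable def inner (x : Diag l n) : Finset (Fin n) :=
  {q | ∃ q' : Fin n, x.mate (.inr q) = .inr q' ∧ (q' : ℕ) = q + 1}

theorem mem_inner {x : Diag l n} {q : Fin n} :
    q ∈ x.inner ↔ ∃ q' : Fin n, x.mate (.inr q) = .inr q' ∧ (q' : ℕ) = q + 1 := by
  simp [inner]

/-- Among the right returns of a diagram, one of least width is innermost. -/
theorem inner_nonempty {x : Diag l n} (hx : x.HasRightReturn) : x.inner.Nonempty := by
  -- Induction on the width of a right return.
  have key : ∀ N (q q' : Fin n), (q' : ℕ) - q = N → x.mate (.inr q) = .inr q' → q < q' →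
      x.inner.Nonempty := by
    intro N
    induction N using Nat.strong_induction_on with
    | _ N ih =>
      intro q q' hN h hlt
      by_cases hq : (q' : ℕ) = q + 1
      · exact ⟨q, mem_inner.2 ⟨q', h, hq⟩⟩
      · obtain ⟨r, h1, h2, h3⟩ := x.exists_mate_between h (s := ⟨q + 1, by omega⟩)
          (Fin.lt_def.2 (by simp)) (Fin.lt_def.2 (by simp only; omega))
        have h4 : r ≠ ⟨q + 1, by omega⟩ := by
          intro h4
          exact x.mate_ne _ (h4 ▸ h1)
        rw [Ne, Fin.ext_iff] at h4
        simp only [Fin.lt_def] at *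
        exact ih (r - (q + 1)) (by omega) _ _ rfl h1 (by simp only; omega)
  obtain ⟨p, q, h⟩ := hx
  rcases lt_trichotomy p q with hlt | rfl | hlt
  · exact key _ _ _ rfl h hlt
  · exact absurd h (x.mate_ne _)
  · exact key _ _ _ rfl (x.mate_symm h) hlt

theorem mate_eq_inr_iff {x : Diag l n} (hx : ¬ x.HasNestedRightReturns) {q q' : Fin n} :
    x.mate (.inr q) = .inr q' ↔ (q ∈ x.upper ∧ (q' : ℕ) = q + 1) ∨
      (q' ∈ x.upper ∧ (q : ℕ) = q' + 1) := by
  constructor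
  · intro h
    rcases lt_trichotomy q q' with hlt | rfl | hlt
    · exact .inl ⟨mem_upper.2 ⟨q', h, hlt⟩, val_eq_of_not_nested hx h hlt⟩
    · exact absurd h (x.mate_ne _)
    · exact .inr ⟨mem_upper.2 ⟨q, x.mate_symm h, hlt⟩,
        val_eq_of_not_nested hx (x.mate_symm h) hlt⟩
  · have key : ∀ {q q' : Fin n}, q ∈ x.upper → (q' : ℕ) = q + 1 → x.mate (.inr q) = .inr q' := by
      intro q q' hq h
      obtain ⟨r, h1, h2⟩ := mem_upper.1 hq
      have := val_eq_of_not_nested hx h1 h2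
      rwa [show q' = r by omega]
    rintro (⟨h1, h2⟩ | ⟨h1, h2⟩)
    · exact key h1 h2
    · exact x.mate_symm (key h1 h2)

theorem upper_eq_inner {x : Diag l n} (hx : ¬ x.HasNestedRightReturns) : x.upper = x.inner := by
  ext q
  rw [mem_upper, mem_inner]
  constructor
  · rintro ⟨q', h, hlt⟩
    exact ⟨q', h, val_eq_of_not_nested hx h hlt⟩
  · rintro ⟨q', h, hlt⟩
    exact ⟨q', h, Fin.lt_def.2 (by omega)⟩

/-- No element of `S` is the last endpoint or directly above another element of `S`: the elements of `S` can
be the upper endpoints of disjoint adjacent pairs. -/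
def Sparse (S : Finset (Fin n)) : Prop :=
  ∀ q ∈ S, ∃ q' : Fin n, (q' : ℕ) = q + 1 ∧ q' ∉ S

theorem Sparse.mono {S T : Finset (Fin n)} (hT : Sparse T) (h : S ⊆ T) : Sparse S := fun q hq =>
  let ⟨q', h1, h2⟩ := hT q (h hq)
  ⟨q', h1, fun h3 => h2 (h h3)⟩

theorem sparse_inner (x : Diag l n) : Sparse x.inner := by
  intro q hq
  obtain ⟨q', h1, h2⟩ := mem_inner.1 hq
  refine ⟨q', h2, fun h3 => ?_⟩
  obtain ⟨r, h4, h5⟩ := mem_inner.1 h3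
  rw [x.mate_symm h1] at h4
  simp only [Sum.inr.injEq] at h4
  omega

theorem range_thru_congr {α : Diag m n} {β : Diag m' n} (hα : α ∈ YTilde m n)
    (hβ : β ∈ YTilde m' n) (h : α.upper = β.upper) :
    Set.range (thru hα.1) = Set.range (thru hβ.1) := by
  simp only [range_thru, ne_eq, mate_eq_inr_iff hα.2, mate_eq_inr_iff hβ.2, h]

/-- The number of left endpoints is the number of right endpoints that are not on a right return. -/
theorem card_eq_of_upper_eq {α : Diag m n} {β : Diag m' n} (hα : α ∈ YTilde m n)
    (hβ : β ∈ YTilde m' n) (h : α.upper = β.upper) : m = m' := by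
  have h1 := Nat.card_range_of_injective (thru_strictMono hα.1).injective
  have h2 := Nat.card_range_of_injective (thru_strictMono hβ.1).injective
  rw [range_thru_congr hα hβ h, h2] at h1
  simpa using h1.symm

/-- An element of `Ỹ` is determined by its right returns: the through arcs join the left endpoints to the
remaining right endpoints in increasing order. -/
theorem eq_of_upper_eq {α β : Diag m n} (hα : α ∈ YTilde m n) (hβ : β ∈ YTilde m n)
    (h : α.upper = β.upper) : α = β := by
  have h1 : thru hα.1 = thru hβ.1 :=
    ((thru_strictMono hα.1).range_inj (thru_strictMono hβ.1)).1 (range_thru_congr hα hβ h)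
  ext1
  funext x
  rcases x with i | q
  · rw [mate_inl hα.1, mate_inl hβ.1, h1]
  · rcases h2 : β.mate (.inr q) with i | q'
    · rw [← thru_eq hβ.1 h2, ← h1, mate_thru hα.1]
    · rwa [mate_eq_inr_iff hα.2, h, ← mate_eq_inr_iff hβ.2]

end Returns

/-! ### Joining two neighbouring through arcs -/

section Cap

variable {m m' n : ℕ} {β : Diag m' n}

theorem cap_not_hasLeftReturn (hm : m + 2 = m') (i : Fin (m + 1)) :
    ¬ (cap hm i).HasLeftReturn := by
  rintro ⟨p, q, h⟩
  simp [cap] at h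

theorem cap_hasRightReturn (hm : m + 2 = m') (i : Fin (m + 1)) : (cap hm i).HasRightReturn :=
  ⟨⟨i, by omega⟩, ⟨i + 1, by omega⟩, by simp [cap]⟩

theorem cap_glue_not_hasLeftReturn (hm : m + 2 = m') (i : Fin (m + 1))
    (hβ : ¬ β.HasLeftReturn) :
    ¬ ((cap hm i).glue β (composable_of_not_hasLeftReturn hβ _)).HasLeftReturn := by
  rintro ⟨p, q, h⟩
  have := (concat_along hβ (cap hm i) (.inl p)).symm.trans h
  rw [mate_inl (cap_not_hasLeftReturn hm i)] at this
  simp [along] at this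

/-- The right returns of `b^i β` are those of `β` and the one that arises from joining the through arcs
`i` and `i + 1`. -/
theorem cap_glue_mate_inr (hm : m + 2 = m') (i : Fin (m + 1)) (hβ : ¬ β.HasLeftReturn)
    {q q' : Fin n} :
    ((cap hm i).glue β (composable_of_not_hasLeftReturn hβ _)).mate (.inr q) = .inr q' ↔
      β.mate (.inr q) = .inr q' ∨
      (q = thru hβ ⟨i, by omega⟩ ∧ q' = thru hβ ⟨i + 1, by omega⟩) ∨
      (q' = thru hβ ⟨i, by omega⟩ ∧ q = thru hβ ⟨i + 1, by omega⟩) := by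
  rw [glue_mate]
  rcases h : β.mate (.inr q) with p | r
  · have h1 := concat_along hβ (cap hm i) (.inr p)
    have h2 : ∀ j, q = thru hβ j ↔ p = j := by
      intro j
      rw [← thru_eq hβ h, (thru_strictMono hβ).injective.eq_iff]
    simp only [along, Sum.map_inr, thru_eq hβ h] at h1
    rw [h1, h2, h2]
    simp only [cap]
    split_ifs <;> simp [Fin.ext_iff] <;> grind
  · rw [concat_inr_of_mate h]
    have h2 : ∀ j, q ≠ thru hβ j := by
      rintro j rfl
      rw [mate_thru] at h
      simp at h
    simp [h2]

theorem thru_lt_thru_succ (hβ : ¬ β.HasLeftReturn) (i : ℕ) (h : i + 1 < m') :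
    thru hβ ⟨i, by omega⟩ < thru hβ ⟨i + 1, h⟩ :=
  thru_strictMono hβ (Fin.lt_def.2 (by simp))

theorem thru_notMem_upper (hβ : ¬ β.HasLeftReturn) (i : Fin m') : thru hβ i ∉ β.upper := by
  rw [mem_upper, mate_thru]
  simp

theorem upper_cap_glue (hm : m + 2 = m') (i : Fin (m + 1)) (hβ : ¬ β.HasLeftReturn) :
    ((cap hm i).glue β (composable_of_not_hasLeftReturn hβ _)).upper =
      insert (thru hβ ⟨i, by omega⟩) β.upper := by
  have h := thru_lt_thru_succ hβ i (by omega)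
  ext q
  simp only [mem_upper, Finset.mem_insert, cap_glue_mate_inr hm i hβ]
  constructor
  · rintro ⟨q', h1 | h1 | h1, h2⟩
    · exact .inr ⟨q', h1, h2⟩
    · exact .inl h1.1
    · rw [h1.1, h1.2] at h2
      exact absurd h (not_lt.2 h2.le)
  · rintro (h1 | ⟨q', h1, h2⟩)
    · exact ⟨_, .inr (.inl ⟨h1, rfl⟩), h1 ▸ h⟩
    · exact ⟨q', .inl h1, h2⟩

/-- Joining two through arcs that end at adjacent endpoints produces no nesting. -/
theorem cap_glue_mem_YTilde (hm : m + 2 = m') (i : Fin (m + 1)) (hβ : β ∈ YTilde m' n)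
    (h : (thru hβ.1 ⟨i + 1, by omega⟩ : ℕ) = thru hβ.1 ⟨i, by omega⟩ + 1) :
    (cap hm i).glue β (composable_of_not_hasLeftReturn hβ.1 _) ∈ YTilde m n := by
  refine ⟨cap_glue_not_hasLeftReturn hm i hβ.1, ?_⟩
  rintro ⟨p, q, q', p', h1, h2, h3, h4, h5⟩
  rw [cap_glue_mate_inr hm i hβ.1] at h1
  simp only [Fin.lt_def] at *
  rcases h1 with h1 | ⟨h1, h1'⟩ | ⟨h1, h1'⟩
  · have := val_eq_of_not_nested hβ.2 h1 (by simp only [Fin.lt_def]; omega)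
    omega
  · have e1 := congrArg Fin.val h1
    have e2 := congrArg Fin.val h1'
    omega
  · have e1 := congrArg Fin.val h1
    have e2 := congrArg Fin.val h1'
    omega

/-- If an adjacent pair of right endpoints is disjoint from the right returns of `β`, then two consecutive
through arcs of `β` end there. -/
theorem exists_thru_eq_of_sparse (hβ : β ∈ YTilde m' n) {e e' : Fin n} (he : (e' : ℕ) = e + 1)
    (heβ : e ∉ β.upper) (hs : Sparse (insert e β.upper)) :
    ∃ (i : ℕ) (hi : i + 1 < m'), thru hβ.1 ⟨i, by omega⟩ = e ∧ thru hβ.1 ⟨i + 1, hi⟩ = e' := by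
  have h0 : e' ∉ β.upper := by
    obtain ⟨r, h1, h2⟩ := hs e (Finset.mem_insert_self _ _)
    rw [show r = e' by omega] at h2
    exact fun h => h2 (Finset.mem_insert_of_mem h)
  have h1 : e ∈ Set.range (thru hβ.1) := by
    rw [range_thru]
    intro q hq
    rcases (mate_eq_inr_iff hβ.2).1 hq with h | h
    · exact heβ h.1
    · obtain ⟨r, h1, h2⟩ := hs q (Finset.mem_insert_of_mem h.1)
      rw [show r = e by omega] at h2
      exact h2 (Finset.mem_insert_self _ _)
  have h2 : e' ∈ Set.range (thru hβ.1) := by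
    rw [range_thru]
    intro q hq
    rcases (mate_eq_inr_iff hβ.2).1 hq with h | h
    · exact h0 h.1
    · rw [show q = e by omega] at h
      exact heβ h.1
  obtain ⟨i, rfl⟩ := h1
  obtain ⟨i', rfl⟩ := h2
  have h3 : i < i' := (thru_strictMono hβ.1).lt_iff_lt.1 (Fin.lt_def.2 (by omega))
  -- A through arc between the two would have to end strictly between `e` and `e + 1`.
  have h4 : (i' : ℕ) = i + 1 := by
    by_contra hne
    have h5 := thru_strictMono hβ.1 (a := i) (b := ⟨i + 1, by omega⟩) (Fin.lt_def.2 (by simp))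
    have h6 := thru_strictMono hβ.1 (a := ⟨i + 1, by omega⟩) (b := i')
      (Fin.lt_def.2 (by simp only [Fin.lt_def] at h3 ⊢; omega))
    simp only [Fin.lt_def] at h5 h6
    omega
  exact ⟨i, by omega, rfl, by congr 1; exact Fin.ext h4.symm⟩

end Cap

end Diag

/-! ### The index sets as sets of disjoint adjacent pairs -/

section Idx

open Diag

variable {n j : ℕ}

theorem Idx.ext_upper {α β : Idx n j} (h : α.1.upper = β.1.upper) : α = β :=
  Subtype.ext (eq_of_upper_eq α.2.2 β.2.2 h)

/-- Adding an adjacent pair to an element of `Ỹ` is multiplication by some `b^i`. -/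
theorem Idx.exists_cap_glue (β : Idx n j) {e : Fin n} (heβ : e ∉ β.1.upper)
    (hs : Sparse (insert e β.1.upper)) :
    ∃ (α : Idx n (j + 1)) (hm : n - 2 * (j + 1) + 2 = n - 2 * j) (i : Fin (n - 2 * (j + 1) + 1)),
      (cap hm i).glue β.1 (composable_of_not_hasLeftReturn β.2.2.1 _) = α.1 ∧
      α.1.upper = insert e β.1.upper ∧ thru β.2.2.1 ⟨i, by omega⟩ = e := by
  obtain ⟨e', he, -⟩ := hs e (Finset.mem_insert_self _ _)
  obtain ⟨i, hi, h1, h2⟩ := exists_thru_eq_of_sparse β.2.2 he heβ hs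
  have hm : n - 2 * (j + 1) + 2 = n - 2 * j := by omega
  refine ⟨⟨(cap hm ⟨i, by omega⟩).glue β.1 (composable_of_not_hasLeftReturn β.2.2.1 _), by omega,
    cap_glue_mem_YTilde hm _ β.2.2 ?_⟩, hm, ⟨i, by omega⟩, rfl, ?_, h1⟩
  · simp only [h1, h2, he]
  · rw [upper_cap_glue hm _ β.2.2.1]
    simp only [h1]

theorem one_mem_YTilde (n : ℕ) : one n ∈ YTilde n n :=
  ⟨by rintro ⟨p, q, h⟩; simp [one] at h, by rintro ⟨p, q, q', p', h, -⟩; simp [one] at h⟩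

theorem upper_one (n : ℕ) : (one n).upper = ∅ := by
  ext q
  simp [mem_upper, one]

/-- Every set of `j` disjoint adjacent pairs is the set of right returns of some element of `Ỹ`. -/
theorem Idx.exists_upper_eq (S : Finset (Fin n)) (hS : Sparse S) (hj : S.card = j) :
    ∃ α : Idx n j, α.1.upper = S := by
  induction S using Finset.induction_on generalizing j with
  | empty =>
    obtain rfl : j = 0 := by simpa using hj.symm
    exact ⟨⟨one n, by omega, one_mem_YTilde n⟩, upper_one n⟩
  | insert e S he ih =>
    rw [Finset.card_insert_of_notMem he] at hj
    subst hj
    obtain ⟨β, hβ⟩ := ih (hS.mono (Finset.subset_insert _ _)) rfl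
    rw [← hβ] at he hS
    obtain ⟨α, -, -, -, h, -⟩ := β.exists_cap_glue he hS
    exact ⟨α, h.trans (by rw [hβ])⟩

theorem Idx.card_upper (α : Idx n j) : α.1.upper.card = j := by
  have hs : Sparse α.1.upper := upper_eq_inner α.2.2.2 ▸ sparse_inner _
  -- Compare `α` with the element of `Ỹ` built from the pairs, whose number of left endpoints is known.
  obtain ⟨β, hβ⟩ := Idx.exists_upper_eq _ hs rfl
  have h1 := card_eq_of_upper_eq β.2.2 α.2.2 hβ
  have h2 := α.2.1
  have h3 := β.2.1
  omega

/-- Removing a right return from an element of `Ỹ`. -/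
theorem Idx.exists_erase (α : Idx n (j + 1)) {e : Fin n} (he : e ∈ α.1.upper) :
    ∃ (β : Idx n j) (hm : n - 2 * (j + 1) + 2 = n - 2 * j) (i : Fin (n - 2 * (j + 1) + 1)),
      (cap hm i).glue β.1 (composable_of_not_hasLeftReturn β.2.2.1 _) = α.1 ∧
      β.1.upper = α.1.upper.erase e ∧ thru β.2.2.1 ⟨i, by omega⟩ = e := by
  have hs : Sparse α.1.upper := upper_eq_inner α.2.2.2 ▸ sparse_inner _
  obtain ⟨β, hβ⟩ := Idx.exists_upper_eq (j := j) (α.1.upper.erase e)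
    (hs.mono (Finset.erase_subset _ _)) (by rw [Finset.card_erase_of_mem he, α.card_upper]; rfl)
  have h1 : insert e β.1.upper = α.1.upper := by rw [hβ, Finset.insert_erase he]
  obtain ⟨α', hm, i, h2, h3, h4⟩ := β.exists_cap_glue (e := e) (by simp [hβ]) (h1 ▸ hs)
  obtain rfl : α' = α := Idx.ext_upper (h3.trans h1)
  exact ⟨β, hm, i, h2, hβ, h4⟩

end Idx

/-! ### Unital modules -/

section Unital

open DirectSum

variable (k : Type*) [Field k]

theorem dgm_mul_dgm_of_composable {n m s : ℕ} {x : Diag n m} {y : Diag m s} (h : x.Composable y) :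
    dgm k x * dgm k y = dgm k (x.glue y h) := by
  rw [dgm, dgm, ← Unitization.inr_mul, Alg.basis_mul]
  simp [Diagram.mul, Diag.comp, h, dgm]

theorem one_comp {n m : ℕ} (x : Diag n m) : (Diag.one n).comp x = some x := by
  have h : (Diag.one n).Composable x := by
    rintro p ⟨⟨q, h⟩, _⟩
    simp [Diag.one] at h
  rw [Diag.comp, dif_pos h]
  congr 1
  ext1
  funext a
  rcases a with i | j
  · simp only [Diag.glue_mate, Diag.concat, Diag.one, Sum.swap_inl]
    rcases x.mate (.inl i) <;> rfl
  · simp only [Diag.glue_mate, Diag.concat, Diag.one, Sum.swap_inr]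
    rcases x.mate (.inr j) <;> rfl

theorem idem_mul_dgm {n m : ℕ} (x : Diag n m) : idem k n * dgm k x = dgm k x := by
  rw [idem, dgm, dgm, ← Unitization.inr_mul, Alg.basis_mul]
  simp [Diagram.mul, one_comp]

theorem dgm_mul_dgm_of_ne {n m m' s : ℕ} (h : m ≠ m') (x : Diag n m) (y : Diag m' s) :
    dgm k x * dgm k y = 0 := by
  rw [dgm, dgm, ← Unitization.inr_mul, Alg.basis_mul]
  simp [Diagram.mul, h]

variable {k} {M N : Type*} [AddCommGroup M] [Module (UAlg k) M] [AddCommGroup N]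
  [Module (UAlg k) N]

theorem mem_idemPart {n : ℕ} {x : M} : x ∈ idemPart k M n ↔ idem k n • x = x := by
  constructor
  · rintro ⟨y, rfl⟩
    change idem k n • idem k n • y = idem k n • y
    rw [smul_smul]
    exact congrArg (· • y) (dgm_mul_idem k _)
  · exact fun h => ⟨x, h⟩

theorem idem_smul_of_ne {n m : ℕ} (h : n ≠ m) {x : M} (hx : x ∈ idemPart k M m) :
    idem k n • x = 0 := by
  rw [← mem_idemPart.1 hx, smul_smul, idem, idem, dgm_mul_dgm_of_ne k h, zero_smul]

/-- As the idempotents `1_n` are orthogonal, the sum of the `1_n M` is always direct. -/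
theorem isUnital_iff : IsUnital k M ↔ ⨆ n, idemPart k M n = ⊤ := by
  have hM : (⨆ n, idemPart k M n) = (DirectSum.coeAddMonoidHom (idemPart k M)).range := by
    apply le_antisymm
    · refine iSup_le fun n x hx => ?_
      exact ⟨DirectSum.of (fun n => idemPart k M n) n ⟨x, hx⟩, by simp⟩
    · rintro _ ⟨x, rfl⟩
      induction x using DirectSum.induction_on with
      | zero => simp
      | of n x => simpa using (le_iSup (idemPart k M) n) x.2
      | add x y hx hy => simpa using add_mem hx hy
  have inj : Function.Injective (DirectSum.coeAddMonoidHom (idemPart k M)) := by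
    rw [injective_iff_map_eq_zero]
    -- Multiplication by `1_n` recovers the component of index `n`.
    have key : ∀ (x : ⨁ n, idemPart k M n) (n : ℕ),
        idem k n • DirectSum.coeAddMonoidHom (idemPart k M) x = x n := by
      intro x n
      induction x using DirectSum.induction_on with
      | zero => simp
      | of m x =>
        rw [DirectSum.coeAddMonoidHom_of]
        by_cases h : n = m
        · subst h
          simpa using mem_idemPart.1 x.2
        · rw [idem_smul_of_ne h x.2, DirectSum.of_eq_of_ne _ _ _ h]
          rfl
      | add x y hx hy => simp [smul_add, hx, hy]
    intro x hx
    ext n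
    rw [← key, hx, smul_zero]
    rfl
  rw [hM, AddMonoidHom.range_eq_top, IsUnital, DirectSum.IsInternal, Function.Bijective]
  exact and_iff_right inj

theorem map_mem_iSup_idemPart (f : M →ₗ[UAlg k] N) {x : M} (hx : x ∈ ⨆ n, idemPart k M n) :
    f x ∈ ⨆ n, idemPart k N n := by
  suffices h : (⨆ n, idemPart k M n) ≤ (⨆ n, idemPart k N n).comap f.toAddMonoidHom from h hx
  refine iSup_le fun n y hy => ?_
  refine (le_iSup (idemPart k N) n) (mem_idemPart.2 ?_)
  change idem k n • f y = f y
  rw [← map_smul, mem_idemPart.1 hy]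

theorem IsUnital.of_surjective (hM : IsUnital k M) (f : M →ₗ[UAlg k] N)
    (hf : Function.Surjective f) : IsUnital k N := by
  rw [isUnital_iff] at *
  refine (AddSubgroup.eq_top_iff' _).2 fun y => ?_
  obtain ⟨x, rfl⟩ := hf y
  exact map_mem_iSup_idemPart f (hM ▸ AddSubgroup.mem_top x)

theorem IsUnital.pi {ι : Type*} [Fintype ι] (hM : IsUnital k M) : IsUnital k (ι → M) := by
  classical
  rw [isUnital_iff] at *
  refine (AddSubgroup.eq_top_iff' _).2 fun y => ?_
  rw [← Finset.univ_sum_single y]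
  exact sum_mem fun i _ => map_mem_iSup_idemPart (LinearMap.single (UAlg k) (fun _ => M) i)
    (hM ▸ AddSubgroup.mem_top (y i))

/-- A diagram with `m` right endpoints as an element of `P_m`. -/
noncomputable def dgmP (k : Type*) [Field k] {l m : ℕ} (x : Diag l m) : P k m :=
  ⟨dgm k x, dgm_mem_P k x⟩

theorem mul_idem_of_mem_P {m : ℕ} (a : P k m) : (a : UAlg k) * idem k m = a := by
  obtain ⟨u, hu⟩ := Submodule.mem_span_singleton.1 a.2
  rw [← hu, smul_eq_mul, mul_assoc]
  congr 1
  exact dgm_mul_idem k _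

/-- The diagrams with `m` right endpoints span `P_m` over `k`. -/
theorem span_dgmP (m : ℕ) :
    Submodule.span k (Set.range fun x : Σ l, Diag l m => dgmP k x.2) = ⊤ := by
  rw [eq_top_iff]
  rintro ⟨a, ha⟩ -
  obtain ⟨u, rfl⟩ := Submodule.mem_span_singleton.1 ha
  have hid : (⟨idem k m, Submodule.mem_span_singleton_self _⟩ : P k m) ∈
      Submodule.span k (Set.range fun x : Σ l, Diag l m => dgmP k x.2) :=
    Submodule.subset_span ⟨⟨m, Diag.one m⟩, rfl⟩
  have key : ∀ u : UAlg k, u • (⟨idem k m, Submodule.mem_span_singleton_self _⟩ : P k m) ∈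
      Submodule.span k (Set.range fun x : Σ l, Diag l m => dgmP k x.2) := by
    intro u
    induction u using Unitization.ind with
    | inl_add_inr r a =>
      rw [add_smul]
      refine add_mem ?_ ?_
      · convert Submodule.smul_mem _ r hid using 1
        ext1
        simp [← Unitization.algebraMap_eq_inl, Algebra.smul_def]
      · induction a using Alg.induction with
        | zero => simp
        | add x y hx hy =>
          rw [Unitization.inr_add, add_smul]
          exact add_mem hx hy
        | smul c x hx =>
          rw [Unitization.inr_smul, smul_assoc]
          exact Submodule.smul_mem _ c hx
        | basis b =>
          obtain ⟨l, m', b⟩ := b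
          by_cases h : m' = m
          · subst h
            refine Submodule.subset_span ⟨⟨l, b⟩, ?_⟩
            ext1
            exact (dgm_mul_idem k b).symm
          · convert Submodule.zero_mem _ using 1
            ext1
            exact dgm_mul_dgm_of_ne k h b _
  exact key u

theorem linearIndependent_dgmP (m : ℕ) :
    LinearIndependent k fun x : Σ l, Diag l m => dgmP k x.2 := by
  let f : P k m →ₗ[k] Alg k :=
    { toFun := fun a => (a : UAlg k).snd
      map_add' := fun _ _ => rfl
      map_smul' := fun _ _ => rfl }
  refine LinearIndependent.of_comp f ?_
  refine (Alg.basis k).linearIndependent.comp (fun x : Σ l, Diag l m => (⟨x.1, m, x.2⟩ : Diagram))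
    fun x y h => ?_
  obtain ⟨l, x⟩ := x
  obtain ⟨l', y⟩ := y
  simp only [Sigma.mk.injEq] at h
  obtain ⟨rfl, h⟩ := h
  simpa using h

/-- The basis of `P_m` consisting of the diagrams with `m` right endpoints. -/
noncomputable def basisP (k : Type*) [Field k] (m : ℕ) : Module.Basis (Σ l, Diag l m) k (P k m) :=
  Module.Basis.mk (linearIndependent_dgmP m) (span_dgmP m).ge

theorem basisP_apply (m : ℕ) (x : Σ l, Diag l m) : basisP k m x = dgmP k x.2 := by
  simp [basisP]

theorem isUnital_P (m : ℕ) : IsUnital k (P k m) := by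
  rw [isUnital_iff, AddSubgroup.eq_top_iff']
  intro a
  have key : ∀ (c : k) (n : ℕ) (x : P k m), x ∈ idemPart k (P k m) n →
      c • x ∈ idemPart k (P k m) n := by
    intro c n x hx
    rw [mem_idemPart] at *
    rw [smul_comm, hx]
  rw [← (basisP k m).linearCombination_repr a, Finsupp.linearCombination_apply]
  refine sum_mem fun x _ => (le_iSup (idemPart k (P k m)) x.1) (key _ _ _ (mem_idemPart.2 ?_))
  rw [basisP_apply]
  ext1
  exact idem_mul_dgm k x.2

end Unital

/-! ### Projectivity in the category of unital modules -/

section Projective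

open CategoryTheory

variable {k : Type u} [Field k]

/-- An epimorphism of unital modules is surjective: its cokernel is again unital. -/
theorem UnitalMod.surjective_of_epi {X Y : UnitalMod k} (f : X ⟶ Y) [Epi f] :
    Function.Surjective f.hom.hom := by
  let C : UnitalMod k := ⟨ModuleCat.of (UAlg k) (Y.obj ⧸ LinearMap.range f.hom.hom),
    Y.property.of_surjective (Submodule.mkQ _) (Submodule.mkQ_surjective _)⟩
  let p : Y ⟶ C := InducedCategory.homMk (ModuleCat.ofHom (Submodule.mkQ _))
  let q : Y ⟶ C := InducedCategory.homMk (ModuleCat.ofHom 0)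
  have h : p = q := by
    rw [← cancel_epi f]
    ext x
    exact (Submodule.Quotient.mk_eq_zero _).2 ⟨x, rfl⟩
  intro y
  have h1 : p.hom.hom y = q.hom.hom y := by rw [h]
  exact (Submodule.Quotient.mk_eq_zero _).1 h1

/-- `P_m` is projective with respect to all surjections, being generated by an idempotent. -/
theorem P_lift {m : ℕ} {M N : Type*} [AddCommGroup M] [Module (UAlg k) M] [AddCommGroup N]
    [Module (UAlg k) N] (e : M →ₗ[UAlg k] N) (he : Function.Surjective e)
    (f : P k m →ₗ[UAlg k] N) : ∃ g : P k m →ₗ[UAlg k] M, e ∘ₗ g = f := by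
  obtain ⟨x, hx⟩ := he (f ⟨idem k m, Submodule.mem_span_singleton_self _⟩)
  refine ⟨LinearMap.toSpanSingleton (UAlg k) M x ∘ₗ (P k m).subtype, ?_⟩
  ext a
  simp only [LinearMap.comp_apply, LinearMap.toSpanSingleton_apply, map_smul, hx]
  rw [← map_smul]
  congr 1
  ext1
  exact mul_idem_of_mem_P a

theorem projective_pi_P {ι : Type} [Finite ι] (m : ℕ) (h : IsUnital k (ι → P k m)) :
    Projective (⟨ModuleCat.of (UAlg k) (ι → P k m), h⟩ : UnitalMod k) := by
  classical
  have := Fintype.ofFinite ι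
  refine ⟨fun {E X} f e _ => ?_⟩
  choose g hg using fun i => P_lift e.hom.hom (UnitalMod.surjective_of_epi e)
    (f.hom.hom ∘ₗ LinearMap.single (UAlg k) (fun _ => P k m) i)
  refine ⟨InducedCategory.homMk (ModuleCat.ofHom (LinearMap.lsum (UAlg k) _ ℕ g)), ?_⟩
  ext1
  ext1
  refine LinearMap.pi_ext' fun i => ?_
  rw [← hg i]
  ext1 a
  simp [LinearMap.lsum_apply]
  rw [Finset.sum_eq_single i (fun b _ hb => by simp [Pi.single_eq_of_ne hb]) (by simp),
    Pi.single_eq_same]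

end Projective

/-! ### Chain complexes of simplices -/

section Simplex

variable {ι : Type*} [LinearOrder ι]

/-- The sign of the face of the simplex `S` that is opposite to the vertex `e`. -/
def faceSign (S : Finset ι) (e : ι) : ℤ := (-1) ^ ((S.filter (· ≤ e)).card - 1)

/-- The vertices are numbered from `0` by the number of smaller ones. -/
theorem faceSign_eq {S : Finset ι} {e : ι} (he : e ∈ S) :
    faceSign S e = (-1) ^ (S.filter (· < e)).card := by
  have h : S.filter (· ≤ e) = insert e (S.filter (· < e)) := by
    ext q
    simp only [Finset.mem_filter, Finset.mem_insert]
    grind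
  rw [faceSign, h, Finset.card_insert_of_notMem (by simp), Nat.add_sub_cancel]

theorem faceSign_insert_of_lt {S : Finset ι} {e f : ι} (he : e ∉ S) (hf : f ∈ S) (h : e < f) :
    faceSign (insert e S) f = -faceSign S f := by
  rw [faceSign_eq hf, faceSign_eq (Finset.mem_insert_of_mem hf), Finset.filter_insert, if_pos h,
    Finset.card_insert_of_notMem (by simp [he]), pow_succ, mul_neg_one]

theorem faceSign_insert_of_gt {S : Finset ι} {e f : ι} (hf : f ∈ S) (h : f < e) :
    faceSign (insert e S) f = faceSign S f := by
  rw [faceSign_eq hf, faceSign_eq (Finset.mem_insert_of_mem hf), Finset.filter_insert,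
    if_neg h.not_gt]

/-- Removing two vertices in the two possible orders gives opposite signs. -/
theorem faceSign_mul_add {S : Finset ι} {e f : ι} (he : e ∈ S) (hf : f ∈ S) (hne : e ≠ f) :
    faceSign S e * faceSign (S.erase e) f + faceSign S f * faceSign (S.erase f) e = 0 := by
  wlog h : e < f generalizing e f
  · rw [add_comm]
    exact this hf he hne.symm (lt_of_le_of_ne (not_lt.1 h) hne.symm)
  have h1 := faceSign_insert_of_lt (S.notMem_erase e) (Finset.mem_erase.2 ⟨hne.symm, hf⟩) h
  have h2 := faceSign_insert_of_gt (Finset.mem_erase.2 ⟨hne, he⟩) h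
  rw [Finset.insert_erase he] at h1
  rw [Finset.insert_erase hf] at h2
  rw [h1, h2]
  ring

variable (k T : Type*) [Field k]

/-- The boundary map on the direct sum of augmented simplicial chain complexes indexed by `T`; a pair
`(D, S)` is the simplex with vertex set `S` in the summand `D`. -/
noncomputable def boundary : (T × Finset ι →₀ k) →ₗ[k] (T × Finset ι →₀ k) :=
  Finsupp.linearCombination k fun x =>
    ∑ e ∈ x.2, faceSign x.2 e • Finsupp.single (x.1, x.2.erase e) (1 : k)

variable {T}

theorem boundary_single (D : T) (S : Finset ι) : boundary k T (Finsupp.single (D, S) 1) =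
    ∑ e ∈ S, faceSign S e • Finsupp.single (D, S.erase e) (1 : k) := by
  simp [boundary]

theorem boundary_boundary (x : T × Finset ι →₀ k) : boundary k T (boundary k T x) = 0 := by
  suffices h : boundary k T ∘ₗ boundary (ι := ι) k T = 0 from DFunLike.congr_fun h x
  refine (Finsupp.basisSingleOne (R := k)).ext fun ⟨D, S⟩ => ?_
  simp only [Finsupp.coe_basisSingleOne, LinearMap.comp_apply, boundary_single, map_sum, map_zsmul,
    LinearMap.zero_apply, Finset.smul_sum, smul_smul]
  rw [Finset.sum_sigma']
  refine Finset.sum_involution (fun x _ => ⟨x.2, x.1⟩) ?_ ?_ ?_ ?_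
  · rintro ⟨e, f⟩ h
    simp only [Finset.mem_sigma, Finset.mem_erase] at h
    simp only [Finset.erase_right_comm (a := f)]
    rw [← add_smul, faceSign_mul_add h.1 h.2.2 h.2.1.symm, zero_smul]
  · rintro ⟨e, f⟩ h - h'
    simp only [Finset.mem_sigma, Finset.mem_erase] at h
    simp only [Sigma.mk.injEq] at h'
    exact h.2.1 h'.1
  · rintro ⟨e, f⟩ h
    simp only [Finset.mem_sigma, Finset.mem_erase] at h ⊢
    exact ⟨h.2.2, h.2.1.symm, h.1⟩
  · rintro ⟨e, f⟩ h
    rfl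

/-- The contraction of the full simplices with nonempty vertex sets `A D`: add the least vertex to the
simplices that do not contain it, and send all others to zero. -/
noncomputable def cone (A : T → Finset ι) : (T × Finset ι →₀ k) →ₗ[k] (T × Finset ι →₀ k) :=
  Finsupp.linearCombination k fun x =>
    if h : (A x.1).Nonempty then
      if (A x.1).min' h ∈ x.2 then 0 else Finsupp.single (x.1, insert ((A x.1).min' h) x.2) 1
    else 0

variable {A : T → Finset ι} {D : T}

theorem cone_single_of_mem (hA : (A D).Nonempty) {S : Finset ι} (h : (A D).min' hA ∈ S) :
    cone k A (Finsupp.single (D, S) 1) = 0 := by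
  simp [cone, hA, h]

theorem cone_single_of_notMem (hA : (A D).Nonempty) {S : Finset ι} (h : (A D).min' hA ∉ S) :
    cone k A (Finsupp.single (D, S) 1) = Finsupp.single (D, insert ((A D).min' hA) S) 1 := by
  simp [cone, hA, h]

/-- `cone` is a contracting homotopy. The sign of the face opposite to the least vertex is `1`; adding the
least vertex changes the signs of all other faces. -/
theorem boundary_cone_add_cone_boundary (hA : (A D).Nonempty) {S : Finset ι} (hS : S ⊆ A D) :
    boundary k T (cone k A (Finsupp.single (D, S) 1)) +
      cone k A (boundary k T (Finsupp.single (D, S) 1)) = Finsupp.single (D, S) 1 := by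
  set e := (A D).min' hA with he
  by_cases h : e ∈ S
  · have hsign : faceSign S e = 1 := by
      rw [faceSign_eq h, Finset.filter_false_of_mem, Finset.card_empty, pow_zero]
      exact fun f hf => not_lt.2 ((A D).min'_le f (hS hf))
    rw [cone_single_of_mem k hA h, map_zero, zero_add, boundary_single, map_sum,
      Finset.sum_eq_single e]
    · rw [map_zsmul, cone_single_of_notMem k hA (by simp [← he]), ← he, Finset.insert_erase h,
        hsign, one_smul]
    · intro f hf hne
      rw [map_zsmul, cone_single_of_mem k hA (Finset.mem_erase.2 ⟨hne.symm, h⟩), smul_zero]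
    · exact fun h' => absurd h h'
  · have hlt : ∀ f ∈ S, e < f := fun f hf =>
      lt_of_le_of_ne ((A D).min'_le f (hS hf)) fun h' => h (h' ▸ hf)
    have hsign : faceSign (insert e S) e = 1 := by
      rw [faceSign_eq (Finset.mem_insert_self _ _), Finset.filter_false_of_mem, Finset.card_empty,
        pow_zero]
      intro f hf
      rcases Finset.mem_insert.1 hf with rfl | hf
      · exact lt_irrefl _
      · exact (hlt f hf).not_gt
    rw [cone_single_of_notMem k hA h, boundary_single, boundary_single, ← he,
      Finset.sum_insert h, hsign, one_smul, Finset.erase_insert h, map_sum, add_assoc,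
      ← Finset.sum_add_distrib, Finset.sum_eq_zero, add_zero]
    intro f hf
    rw [map_zsmul, cone_single_of_notMem k hA (fun h' => h (Finset.mem_of_mem_erase h')), ← he,
      faceSign_insert_of_lt h hf (hlt f hf), Finset.erase_insert_of_ne (hlt f hf).ne, neg_smul,
      neg_add_cancel]

end Simplex

open Diag

/-! ### The resolution as a sum of simplicial chain complexes -/

section Pairs

variable (k : Type*) [Field k] {n j : ℕ}

/-- The product `a α` of a diagram with an element of `Ỹ`; it is never zero. -/
noncomputable def Idx.lmul (α : Idx n j) {l : ℕ} (a : Diag l (n - 2 * j)) : Diag l n :=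
  a.glue α.1 (composable_of_not_hasLeftReturn α.2.2.1 a)

/-- The basis element `a` of the summand `P_{n-2j}^α` as the pair of the diagram `a α` and the set of those of
its innermost right returns that come from `α`. -/
noncomputable def pair (b : Σ _ : Idx n j, Σ l, Diag l (n - 2 * j)) :
    (Σ l, Diag l n) × Finset (Fin n) :=
  (⟨b.2.1, b.1.lmul b.2.2⟩, b.1.1.upper)

theorem pair_injective : Function.Injective (pair (n := n) (j := j)) := by
  rintro ⟨α, l, a⟩ ⟨β, l', b⟩ h
  simp only [pair, Prod.mk.injEq, Sigma.mk.injEq] at h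
  obtain ⟨⟨rfl, h1⟩, h2⟩ := h
  obtain rfl := Idx.ext_upper h2
  obtain rfl := glue_left_injective α.2.2.1 (eq_of_heq h1)
  rfl

theorem pair_subset_inner (b : Σ _ : Idx n j, Σ l, Diag l (n - 2 * j)) :
    (pair b).2 ⊆ (pair b).1.2.inner := by
  intro q hq
  rw [pair, upper_eq_inner b.1.2.2.2, mem_inner] at hq
  obtain ⟨q', h1, h2⟩ := hq
  exact mem_inner.2 ⟨q', concat_inr_of_mate h1, h2⟩

theorem exists_pair_eq {l : ℕ} (D : Diag l n) {S : Finset (Fin n)} (hS : S ⊆ D.inner)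
    (hj : S.card = j) : ∃ b : Σ _ : Idx n j, Σ l, Diag l (n - 2 * j), pair b = (⟨l, D⟩, S) := by
  obtain ⟨α, rfl⟩ := Idx.exists_upper_eq S ((sparse_inner D).mono hS) hj
  obtain ⟨a, ha⟩ := exists_glue_eq α.2.2.1 D fun q q' h => by
    have key : ∀ {q q' : Fin n}, q ∈ α.1.upper → (q' : ℕ) = q + 1 →
        D.mate (.inr q) = .inr q' := by
      intro q q' hq h
      obtain ⟨r, h1, h2⟩ := mem_inner.1 (hS hq)
      rwa [show q' = r by omega]
    rcases (mate_eq_inr_iff α.2.2.2).1 h with ⟨h1, h2⟩ | ⟨h1, h2⟩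
    · exact key h1 h2
    · exact D.mate_symm (key h1 h2)
  exact ⟨⟨α, l, a⟩, by rw [pair, Idx.lmul, ha]⟩

variable (n j)

/-- The basis of the `j`-th term that consists of the diagrams in its summands. -/
noncomputable def termBasis :
    Module.Basis (Σ _ : Idx n j, Σ l, Diag l (n - 2 * j)) k (Term k n j) :=
  Pi.basis fun _ => basisP k (n - 2 * j)

/-- The embedding of the `j`-th term into the chain complex of simplices. -/
noncomputable def toPairs : Term k n j →ₗ[k] ((Σ l, Diag l n) × Finset (Fin n) →₀ k) :=
  Finsupp.lmapDomain k k pair ∘ₗ (termBasis k n j).repr.toLinearMap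

variable {n j}

open Classical in
theorem termBasis_apply (b : Σ _ : Idx n j, Σ l, Diag l (n - 2 * j)) :
    termBasis k n j b = Pi.single b.1 (dgmP k b.2.2) := by
  rw [termBasis, Pi.basis_apply, basisP_apply]

theorem toPairs_termBasis (b : Σ _ : Idx n j, Σ l, Diag l (n - 2 * j)) :
    toPairs k n j (termBasis k n j b) = Finsupp.single (pair b) 1 := by
  simp [toPairs]

open Classical in
theorem toPairs_single (α : Idx n j) {l : ℕ} (a : Diag l (n - 2 * j)) :
    toPairs k n j (Pi.single α (dgmP k a)) = Finsupp.single (⟨l, α.lmul a⟩, α.1.upper) 1 := by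
  rw [← termBasis_apply k ⟨α, l, a⟩, toPairs_termBasis, pair]

theorem toPairs_injective : Function.Injective (toPairs k n j) :=
  (Finsupp.mapDomain_injective pair_injective).comp (termBasis k n j).repr.injective

theorem returnOrder_eq {m m' : ℕ} (α : Diag m n) {β : Diag m' n} (hβ : ¬ β.HasLeftReturn)
    (i : Fin m') : returnOrder α β i = (α.upper.filter (· ≤ thru hβ i)).card := by
  rw [returnOrder, ← Set.ncard_coe_finset]
  congr 1
  ext q
  simp [mem_upper, mate_inl hβ]
  grind

theorem rightMul_dgmP {l m m' : ℕ} {c : Diag m m'} (hc : ¬ c.HasLeftReturn) (a : Diag l m) :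
    rightMul k c (dgmP k a) = dgmP k (a.glue c (composable_of_not_hasLeftReturn hc a)) := by
  ext1
  exact dgm_mul_dgm_of_composable k _

/-- For `α = b^i β`, the sign of the component `d_{j+1,β,α}` is that of the face of `α` opposite to the
right return that comes from `b^i`. -/
theorem dComp_dgmP {α : Idx n (j + 1)} {β : Idx n j} (hm : n - 2 * (j + 1) + 2 = n - 2 * j)
    {i : Fin (n - 2 * (j + 1) + 1)}
    (h : (cap hm i).glue β.1 (composable_of_not_hasLeftReturn β.2.2.1 _) = α.1)
    {l : ℕ} (a : Diag l (n - 2 * (j + 1))) :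
    dComp k n α β (dgmP k a) = faceSign α.1.upper (thru β.2.2.1 ⟨i, by omega⟩) •
      dgmP k (a.glue (cap hm i) (composable_of_not_hasLeftReturn (cap_not_hasLeftReturn hm i) a)) := by
  have hex : ∃ i, (cap hm i).comp β.1 = some α.1 :=
    ⟨i, by rw [Diag.comp, dif_pos (composable_of_not_hasLeftReturn β.2.2.1 _), h]⟩
  -- The index is unique, as the new right return starts at the end of the through arc `i`.
  have hi : hex.choose = i := by
    have h1 := hex.choose_spec
    rw [Diag.comp, dif_pos (composable_of_not_hasLeftReturn β.2.2.1 _), Option.some.injEq] at h1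
    have h2 := congrArg Diag.upper (h1.trans h.symm)
    rw [upper_cap_glue hm _ β.2.2.1, upper_cap_glue hm _ β.2.2.1] at h2
    have h3 := Finset.mem_insert_self (thru β.2.2.1 ⟨hex.choose, by omega⟩) β.1.upper
    rw [h2, Finset.mem_insert, or_iff_left (thru_notMem_upper _ _)] at h3
    have h4 := (thru_strictMono β.2.2.1).injective h3
    simp only [Fin.mk.injEq] at h4
    exact Fin.ext h4
  rw [dComp, dif_pos hex, LinearMap.smul_apply, rightMul_dgmP k (cap_not_hasLeftReturn hm _),
    returnOrder_eq _ β.2.2.1]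
  simp only [hi]
  rfl

theorem dComp_eq_zero {α : Idx n (j + 1)} {β : Idx n j}
    (h : ∀ (hm : n - 2 * (j + 1) + 2 = n - 2 * j) (i : Fin (n - 2 * (j + 1) + 1)),
      (cap hm i).glue β.1 (composable_of_not_hasLeftReturn β.2.2.1 _) ≠ α.1) :
    dComp k n α β = 0 := by
  rw [dComp, dif_neg]
  rintro ⟨i, hi⟩
  rw [Diag.comp, dif_pos (composable_of_not_hasLeftReturn β.2.2.1 _), Option.some.injEq] at hi
  exact h _ _ hi

open Classical in
theorem d_single (α : Idx n (j + 1)) (x : P k (n - 2 * (j + 1))) :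
    d k n j (Pi.single α x) = ∑ β, Pi.single β (dComp k n α β x) := by
  ext1 β
  rw [Finset.sum_apply, Finset.sum_pi_single, if_pos (Finset.mem_univ _), d, LinearMap.pi_apply,
    LinearMap.sum_apply, Finset.sum_eq_single α]
  · simp
  · intro α' _ h
    simp [Pi.single_eq_of_ne h]
  · simp

/-- The differential removes the right returns of `α` one by one, with alternating signs. -/
theorem toPairs_d (x : Term k n (j + 1)) :
    toPairs k n j (d k n j x) = boundary k _ (toPairs k n (j + 1) x) := by
  classical
  suffices h : toPairs k n j ∘ₗ (d k n j).restrictScalars k =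
      boundary k _ ∘ₗ toPairs k n (j + 1) from DFunLike.congr_fun h x
  refine (termBasis k n (j + 1)).ext fun ⟨α, l, a⟩ => ?_
  simp only [LinearMap.comp_apply, LinearMap.restrictScalars_apply, termBasis_apply, d_single,
    map_sum, toPairs_single, boundary_single]
  -- Only the `β` that arise from `α` by removing a right return `e` contribute to the left-hand side.
  choose β hm i h1 h2 h3 using fun e : {e // e ∈ α.1.upper} => α.exists_erase e.2
  rw [← Finset.sum_coe_sort α.1.upper]
  symm
  refine Finset.sum_of_injOn β ?_ (fun _ _ => Finset.mem_coe.2 (Finset.mem_univ _)) ?_ ?_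
  · intro e _ f _ h
    have h4 := h2 e
    rw [h, h2 f] at h4
    by_contra hne
    have h5 : (e : Fin n) ∈ α.1.upper.erase f :=
      Finset.mem_erase.2 ⟨fun h' => hne (Subtype.ext h'), e.2⟩
    rw [h4] at h5
    simp at h5
  · intro γ _ hγ
    rw [dComp_eq_zero, LinearMap.zero_apply, Pi.single_zero, map_zero]
    intro hm' i' h
    have h4 := upper_cap_glue hm' i' γ.2.2.1
    rw [h] at h4
    have h5 : thru γ.2.2.1 ⟨i', by omega⟩ ∈ α.1.upper := by
      rw [h4]
      exact Finset.mem_insert_self _ _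
    refine hγ ⟨⟨_, h5⟩, by simp, Idx.ext_upper ?_⟩
    refine (h2 _).trans ((congrArg (Finset.erase · _) h4).trans ?_)
    exact Finset.erase_insert (thru_notMem_upper _ _)
  · intro e _
    rw [dComp_dgmP k (hm e) (h1 e), h3, Pi.single_zsmul, map_zsmul, toPairs_single, h2]
    congr 3
    have h4 := composable_of_not_hasLeftReturn (β e).2.2.1 (cap (hm e) (i e))
    have h5 := composable_of_not_hasLeftReturn (cap_not_hasLeftReturn (hm e) (i e)) a
    have h6 := glue_assoc h5 h4 (composable_of_not_hasLeftReturn (β e).2.2.1 _)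
      ((composable_glue_iff h5 h4).1 (composable_of_not_hasLeftReturn (β e).2.2.1 _))
    simp only [Idx.lmul]
    rw [h6]
    simp only [h1]

/-! ### Exactness -/

/-- The contraction preserves the condition that `S` consists of innermost right returns of `D`, which
describes the image of the terms. -/
theorem cone_toPairs_mem_range (x : Term k n j) :
    cone k (fun D : Σ l, Diag l n => D.2.inner) (toPairs k n j x) ∈
      LinearMap.range (toPairs k n (j + 1)) := by
  suffices h : (⊤ : Submodule k (Term k n j)) ≤ (LinearMap.range (toPairs k n (j + 1))).comap
      (cone k (fun D : Σ l, Diag l n => D.2.inner) ∘ₗ toPairs k n j) from h (Submodule.mem_top)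
  rw [← (termBasis k n j).span_eq, Submodule.span_le]
  rintro _ ⟨b, rfl⟩
  rw [SetLike.mem_coe, Submodule.mem_comap, LinearMap.comp_apply, toPairs_termBasis]
  by_cases hA : (pair b).1.2.inner.Nonempty
  · by_cases h : (pair b).1.2.inner.min' hA ∈ (pair b).2
    · rw [← Prod.mk.eta (p := pair b), cone_single_of_mem k (D := (pair b).1) hA h]
      exact zero_mem _
    · rw [← Prod.mk.eta (p := pair b), cone_single_of_notMem k (D := (pair b).1) hA h]
      obtain ⟨b', hb'⟩ := exists_pair_eq (j := j + 1) (pair b).1.2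
        (Finset.insert_subset (Finset.min'_mem _ hA) (pair_subset_inner b))
        (by rw [Finset.card_insert_of_notMem h, pair, Idx.card_upper])
      exact ⟨termBasis k n (j + 1) b', by rw [toPairs_termBasis, hb']⟩
  · simp [cone, hA]

/-- In positive degrees `S` is nonempty, so that `D` has an innermost right return and `cone` contracts its
summand. -/
theorem boundary_cone_toPairs (x : Term k n (j + 1)) :
    boundary k _ (cone k (fun D : Σ l, Diag l n => D.2.inner) (toPairs k n (j + 1) x)) +
      cone k (fun D : Σ l, Diag l n => D.2.inner) (boundary k _ (toPairs k n (j + 1) x)) =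
      toPairs k n (j + 1) x := by
  suffices h : boundary k _ ∘ₗ cone k (fun D : Σ l, Diag l n => D.2.inner) ∘ₗ
      toPairs k n (j + 1) + cone k (fun D : Σ l, Diag l n => D.2.inner) ∘ₗ boundary k _ ∘ₗ
      toPairs k n (j + 1) = toPairs k n (j + 1) from DFunLike.congr_fun h x
  refine (termBasis k n (j + 1)).ext fun b => ?_
  simp only [LinearMap.add_apply, LinearMap.comp_apply, toPairs_termBasis]
  refine boundary_cone_add_cone_boundary k (D := (pair b).1) (S := (pair b).2) ?_
    (pair_subset_inner b)
  refine Finset.Nonempty.mono (pair_subset_inner b) (Finset.card_pos.1 ?_)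
  rw [pair, Idx.card_upper]
  exact Nat.succ_pos j

theorem exact_d (j : ℕ) : Function.Exact (d k n (j + 1)) (d k n j) := by
  intro x
  constructor
  · intro hx
    obtain ⟨z, hz⟩ := cone_toPairs_mem_range k x
    refine ⟨z, toPairs_injective k ?_⟩
    have h := boundary_cone_toPairs k x
    rwa [← toPairs_d, hx, map_zero, map_zero, add_zero, ← hz, ← toPairs_d] at h
  · rintro ⟨z, rfl⟩
    apply toPairs_injective k
    rw [toPairs_d, toPairs_d, boundary_boundary, map_zero]

/-! ### The augmentation -/

variable (n) in
/-- The only element `1_n` of `Ỹ_{n,n}`. -/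
def Idx.unit : Idx n 0 := ⟨one n, by omega, one_mem_YTilde n⟩

theorem Idx.eq_unit (α : Idx n 0) : α = Idx.unit n := by
  apply Idx.ext_upper
  exact (Finset.card_eq_zero.1 α.card_upper).trans (upper_one n).symm

theorem Idx.unit_lmul {l : ℕ} (x : Diag l n) : (Idx.unit n).lmul x = x := by
  have h := comp_one x
  rw [Diag.comp, dif_pos (composable_of_not_hasLeftReturn (one_mem_YTilde n).1 x)] at h
  exact Option.some.inj h

theorem augmentation_apply (x : Term k n 0) :
    augmentation k n x = (I k n).mkQ (x (Idx.unit n)) := by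
  rw [augmentation, LinearMap.comp_apply, LinearMap.sum_apply,
    Finset.sum_eq_single (Idx.unit n) (fun α _ h => absurd α.eq_unit h) (by simp)]
  rfl

theorem surjective_augmentation : Function.Surjective (augmentation k n) := by
  intro y
  obtain ⟨a, rfl⟩ := (I k n).mkQ_surjective y
  exact ⟨fun _ => a, augmentation_apply k _⟩

theorem dComp_mem_I (α : Idx n 1) (β : Idx n 0) (a : P k (n - 2 * 1)) :
    dComp k n α β a ∈ I k n := by
  rw [dComp]
  split_ifs with h
  · refine zsmul_mem (Submodule.smul_mem (I k n) (a : UAlg k) (Submodule.subset_span ?_)) _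
    exact ⟨_, _, cap_hasRightReturn _ _, rfl⟩
  · exact zero_mem (I k n)

/-- The image of the differential in degree zero is `I_n`: a diagram `D` with a right return is the boundary
of `(D, {e})` for any innermost right return `e` of `D`. -/
theorem exact_augmentation : Function.Exact (d k n 0) (augmentation k n) := by
  classical
  intro x
  rw [augmentation_apply, Submodule.mkQ_apply, Submodule.Quotient.mk_eq_zero]
  constructor
  · intro hx
    suffices h : I k n ≤ LinearMap.range
        ((LinearMap.proj (Idx.unit n) : Term k n 0 →ₗ[UAlg k] P k n) ∘ₗ d k n 0) by
      obtain ⟨z, hz⟩ := h hx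
      refine ⟨z, funext fun α => ?_⟩
      rw [α.eq_unit]
      exact hz
    refine Submodule.span_le.2 ?_
    rintro a ⟨l, D, hD, ha⟩
    obtain rfl : a = dgmP k D := Subtype.ext ha
    obtain ⟨e, he⟩ := inner_nonempty hD
    obtain ⟨b, hb⟩ := exists_pair_eq (j := 1) D (Finset.singleton_subset_iff.2 he) (by simp)
    have h : d k n 0 (termBasis k n 1 b) = Pi.single (Idx.unit n) (dgmP k D) := by
      apply toPairs_injective k
      rw [toPairs_d, toPairs_termBasis, hb, boundary_single, toPairs_single, Idx.unit_lmul,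
        Finset.sum_singleton, faceSign_eq (Finset.mem_singleton_self e),
        Finset.filter_false_of_mem (by simp), Finset.card_empty, pow_zero, one_smul,
        Finset.erase_singleton, show (Idx.unit n).1.upper = ∅ from upper_one n]
    refine ⟨termBasis k n 1 b, ?_⟩
    rw [LinearMap.comp_apply, h]
    exact Pi.single_eq_same _ _
  · rintro ⟨z, rfl⟩
    rw [d, LinearMap.pi_apply, LinearMap.sum_apply]
    exact Submodule.sum_mem (I k n) fun α _ => dComp_mem_I k α _ _

end Pairs

end ChebTL

theorem mainTheorem2 (k : Type*) [Field k] (n : ℕ) :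
    ChebTL.IsUnital k (ChebTL.StdMod k n) ∧
    (∀ j, Module.Finite (ChebTL.UAlg k) (ChebTL.Term k n j) ∧
      ∃ h : ChebTL.IsUnital k (ChebTL.Term k n j), CategoryTheory.Projective
        (⟨ModuleCat.of (ChebTL.UAlg k) (ChebTL.Term k n j), h⟩ : ChebTL.UnitalMod k)) ∧
    (∀ j, n < 2 * j → Subsingleton (ChebTL.Term k n j)) ∧
    (∀ j, Function.Exact (ChebTL.d k n (j + 1)) (ChebTL.d k n j)) ∧
    Function.Exact (ChebTL.d k n 0) (ChebTL.augmentation k n) ∧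
    Function.Surjective (ChebTL.augmentation k n) := by
  refine ⟨(ChebTL.isUnital_P n).of_surjective _ (Submodule.mkQ_surjective _), fun j => ⟨?_,
    (ChebTL.isUnital_P _).pi, ChebTL.projective_pi_P _ _⟩, fun j hj => ?_, ChebTL.exact_d k,
    ChebTL.exact_augmentation k, ChebTL.surjective_augmentation k⟩
  · have : Module.Finite (ChebTL.UAlg k) (ChebTL.P k (n - 2 * j)) :=
      Module.Finite.of_fg (Submodule.fg_span_singleton _)
    infer_instance
  · have : IsEmpty (ChebTL.Idx n j) := ⟨fun α => by have := α.2.1; omega⟩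
    infer_instance
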